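/- **Setting.** Let $I$ be a set of sites with a (pseudo)metric $\mathrm{dist}$, and let site $i$ host $n_i\in\mathbb N$ qudits, all of the same finite dimension $q\ge 1$, so that its Hilbert space is $\mathcal H_i=(\mathbb C^q)^{\otimes n_i}$. There are no ancilla qudits. Let $\mathcal A$ be the $*$-algebra of operators on $\bigotimes_i\mathcal H_i$ that are supported on finitely many sites. An $R$-QCA is a $*$-automorphism $\alpha$ of $\mathcal A$ such that, for every set $J$ of sites, $\alpha$ maps operators supported on $J$ to operators supported on the radius $R$ neighborhood of $J$. A quantum circuit of depth $D\ge1$ with gates of range $r$ is a sequence of $D$ rounds; a round is a product of unitaries (gates) $U_S\in\mathcal A$ supported on pairwise disjoint sets $S\subset I$ of diameter at most $r$. Its range is $rD$. An automorphism is said to be equal to the circuit if the circuit acts by conjugation as this automorphism. **Density assumption up to scale $\ell_0$**, with constants $0<c\le c'$ and $d>0$: for every site $x$ and every real $\ell$ with $1\le\ell\le\ell_0$, at least $\lfloor c\,\ell^{d}\rfloor$ qudits lie within distance $\ell$ of $x$, and at most $\lfloor c'\ell^{d-1}\rfloor$ qudits lie at a distance from $x$ in the interval $[\ell-1,\ell]$.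 **Corollary.** Let $0<c\le c'$ and $d>0$. 1. For every $R>0$ there are $\ell_0$, $D$ and $\rho$, depending only on $R,c,c',d$, such that for every system as above (with finitely or infinitely many sites) that satisfies the density assumption up to scale $\ell_0$, and for any two $R$-QCA $\alpha,\beta$ on it, the commutator $\alpha\circ\beta\circ\alpha^{-1}\circ\beta^{-1}$ is equal to a quantum circuit, without ancillas, of depth at most $D$ and range at most $\rho$. 2. Hence, on every system that satisfies the density assumption with constants $c,c',d$ up to every scale $\ell_0$, QCA modulo circuits form an abelian group even without ancillas: in the group generated by all QCA of finite range, the automorphisms that are equal to quantum circuits form a normal subgroup, and the quotient is commutative. -/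

import Mathlib

universe u v

noncomputable section

namespace QCA

section Algebra

variable {I : Type u} (σ : I → Type v)

/-- Basis configurations of `⨂ i, H_i`, where `H_i = ℂ^(σ i)` has the orthonormal basis `σ i`. -/
abbrev Config := ∀ i, σ i

/-- The Hilbert space `ℓ²` of the set of all configurations. For finitely many sites this is
`⨂ i, H_i`; in general it is a Hilbert space on which all operators of the form
(operator on finitely many sites) `⊗` (identity on the other sites) act faithfully. -/
abbrev HilbertSpace := lp (fun _ : Config σ => ℂ) 2

variable {σ}

open Classical in
theorem sum_update_le (i : I) [Fintype (σ i)] (b : σ i) (ψ : HilbertSpace σ)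
    (A : Finset (Config σ)) :
    ∑ s ∈ A, ‖ψ (Function.update s i b)‖ ^ 2 ≤ Fintype.card (σ i) * ‖ψ‖ ^ 2 := by
  rw [← Finset.sum_fiberwise A (fun s => s i)]
  have key : ∀ a : σ i, ∑ s ∈ A with s i = a, ‖ψ (Function.update s i b)‖ ^ 2 ≤ ‖ψ‖ ^ 2 := by
    intro a
    have hinj : Set.InjOn (fun s : Config σ => Function.update s i b)
        (A.filter (fun s => s i = a) : Finset (Config σ)) := by
      intro s hs t ht hst
      have hs' : s i = a := (Finset.mem_filter.1 hs).2
      have ht' : t i = a := (Finset.mem_filter.1 ht).2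
      funext j
      by_cases hj : j = i
      · subst hj; rw [hs', ht']
      · have := congrFun hst j
        simpa [Function.update_of_ne hj] using this
    have h1 := Finset.sum_image (f := fun t => ‖ψ t‖ ^ 2) hinj
    rw [← h1]
    have h2 := lp.sum_rpow_le_norm_rpow (p := 2) (by norm_num) ψ
      ((A.filter (fun s => s i = a)).image (fun s => Function.update s i b))
    simpa using h2
  calc _ ≤ ∑ _a : σ i, ‖ψ‖ ^ 2 := Finset.sum_le_sum (fun a _ => key a)
    _ = _ := by simp

open Classical in
theorem sum_siteOp_le (i : I) [Fintype (σ i)] (M : Matrix (σ i) (σ i) ℂ) (ψ : HilbertSpace σ)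
    (A : Finset (Config σ)) :
    ∑ s ∈ A, ‖∑ b, M (s i) b * ψ (Function.update s i b)‖ ^ 2
      ≤ ((∑ a, ∑ b, ‖M a b‖) * (Fintype.card (σ i)) ^ 2 * ‖ψ‖) ^ 2 := by
  set m := ∑ a, ∑ b, ‖M a b‖ with hm
  set N := Fintype.card (σ i) with hN
  have hm0 : 0 ≤ m := by positivity
  have hle : ∀ a b, ‖M a b‖ ≤ m := fun a b =>
    (Finset.single_le_sum (f := fun b => ‖M a b‖) (fun _ _ => norm_nonneg _)
      (Finset.mem_univ b)).trans
    (Finset.single_le_sum (f := fun a => ∑ b, ‖M a b‖)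
      (fun _ _ => Finset.sum_nonneg fun _ _ => norm_nonneg _) (Finset.mem_univ a))
  have h1 : ∀ s : Config σ, ‖∑ b, M (s i) b * ψ (Function.update s i b)‖ ^ 2
      ≤ m ^ 2 * N * ∑ b, ‖ψ (Function.update s i b)‖ ^ 2 := by
    intro s
    have h2 : ‖∑ b, M (s i) b * ψ (Function.update s i b)‖
        ≤ m * ∑ b, ‖ψ (Function.update s i b)‖ := by
      refine (norm_sum_le _ _).trans ?_
      rw [Finset.mul_sum]
      refine Finset.sum_le_sum fun b _ => ?_
      rw [norm_mul]
      exact mul_le_mul_of_nonneg_right (hle _ _) (norm_nonneg _)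
    have h3 : (∑ b, ‖ψ (Function.update s i b)‖) ^ 2
        ≤ N * ∑ b, ‖ψ (Function.update s i b)‖ ^ 2 := by
      simpa using sq_sum_le_card_mul_sum_sq (s := Finset.univ)
        (f := fun b => ‖ψ (Function.update s i b)‖)
    calc _ ≤ (m * ∑ b, ‖ψ (Function.update s i b)‖) ^ 2 :=
          pow_le_pow_left₀ (norm_nonneg _) h2 2
      _ = m ^ 2 * (∑ b, ‖ψ (Function.update s i b)‖) ^ 2 := by ring
      _ ≤ m ^ 2 * (N * ∑ b, ‖ψ (Function.update s i b)‖ ^ 2) := by gcongr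
      _ = _ := by ring
  have hN34 : (N : ℝ) ^ 3 ≤ (N : ℝ) ^ 4 := by
    exact_mod_cast (show N ^ 3 ≤ N ^ 4 by
      rcases Nat.eq_zero_or_pos N with h | h
      · simp [h]
      · exact Nat.pow_le_pow_right h (by norm_num))
  calc _ ≤ ∑ s ∈ A, m ^ 2 * N * ∑ b, ‖ψ (Function.update s i b)‖ ^ 2 :=
        Finset.sum_le_sum fun s _ => h1 s
    _ = m ^ 2 * N * ∑ b, ∑ s ∈ A, ‖ψ (Function.update s i b)‖ ^ 2 := by
        rw [← Finset.mul_sum, Finset.sum_comm]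
    _ ≤ m ^ 2 * N * ∑ _b : σ i, N * ‖ψ‖ ^ 2 := by
        gcongr with b _
        exact sum_update_le i b ψ A
    _ = m ^ 2 * ‖ψ‖ ^ 2 * (N : ℝ) ^ 3 := by
        rw [Finset.sum_const, Finset.card_univ, nsmul_eq_mul]; ring
    _ ≤ m ^ 2 * ‖ψ‖ ^ 2 * (N : ℝ) ^ 4 := by gcongr
    _ = _ := by ring

open Classical in
/-- The operator `M ⊗ id`, where the matrix `M` acts on the Hilbert space of site `i`
and the identity acts on all other sites. -/
def siteOp (i : I) [Fintype (σ i)] (M : Matrix (σ i) (σ i) ℂ) :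
    HilbertSpace σ →L[ℂ] HilbertSpace σ :=
  LinearMap.mkContinuous
    { toFun := fun ψ => ⟨fun s => ∑ b, M (s i) b * ψ (Function.update s i b),
        memℓp_gen' (C := ((∑ a, ∑ b, ‖M a b‖) * (Fintype.card (σ i)) ^ 2 * ‖ψ‖) ^ 2)
          (fun A => by simpa using sum_siteOp_le i M ψ A)⟩
      map_add' := fun ψ φ => by
        ext s
        simp only [lp.coeFn_add, Pi.add_apply, mul_add, Finset.sum_add_distrib]
      map_smul' := fun z ψ => by
        ext s
        simp [Finset.mul_sum, mul_left_comm] }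
    ((∑ a, ∑ b, ‖M a b‖) * (Fintype.card (σ i)) ^ 2)
    (fun ψ => by
      refine lp.norm_le_of_forall_sum_le (by norm_num) (by positivity) (fun A => ?_)
      simpa using sum_siteOp_le i M ψ A)

variable (σ)
variable [∀ i, Fintype (σ i)]

/-- The `*`-algebra of operators supported on a set `J` of sites: it is generated by the operators
on the single sites of `J`. For finite `J` it is `⨂_{i ∈ J} End(H_i)` tensored with the identity
on the other sites; for infinite `J` it is the union of these algebras over the finite subsets
of `J`. -/
def algebraOn (J : Set I) : StarSubalgebra ℂ (HilbertSpace σ →L[ℂ] HilbertSpace σ) :=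
  StarAlgebra.adjoin ℂ {T | ∃ i ∈ J, ∃ M : Matrix (σ i) (σ i) ℂ, T = siteOp i M}

/-- The algebra of all operators that are supported on finitely many sites. -/
abbrev LocalAlgebra := algebraOn σ (Set.univ : Set I)

/-- The group of `*`-automorphisms of the algebra of local operators;
the product is composition. -/
abbrev Aut := LocalAlgebra σ ≃⋆ₐ[ℂ] LocalAlgebra σ

variable {σ}

/-- The support of the local operator `O` is contained in the set `J` of sites. -/
def SupportedOn (O : LocalAlgebra σ) (J : Set I) : Prop :=
  (O : HilbertSpace σ →L[ℂ] HilbertSpace σ) ∈ algebraOn σ J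

theorem SupportedOn.mono {O : LocalAlgebra σ} {J K : Set I} (h : SupportedOn O J) (hJK : J ⊆ K) :
    SupportedOn O K :=
  StarAlgebra.adjoin_mono (R := ℂ)
    (s := {T | ∃ i ∈ J, ∃ M : Matrix (σ i) (σ i) ℂ, T = siteOp i M})
    (t := {T | ∃ i ∈ K, ∃ M : Matrix (σ i) (σ i) ℂ, T = siteOp i M})
    (fun _ ⟨i, hi, hM⟩ => ⟨i, hJK hi, hM⟩) h

theorem SupportedOn.mul {O P : LocalAlgebra σ} {J : Set I} (h : SupportedOn O J)
    (h' : SupportedOn P J) : SupportedOn (O * P) J := by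
  unfold SupportedOn at *
  exact mul_mem h h'

theorem SupportedOn.star {O : LocalAlgebra σ} {J : Set I} (h : SupportedOn O J) :
    SupportedOn (star O) J := by
  unfold SupportedOn at *
  exact star_mem h

theorem supportedOn_one (J : Set I) : SupportedOn (1 : LocalAlgebra σ) J := by
  unfold SupportedOn
  exact one_mem _

end Algebra

section Locality

variable {I : Type u} [PseudoMetricSpace I]

/-- The radius `R` neighborhood of a set of sites. -/
def neighborhood (R : ℝ) (J : Set I) : Set I := {i | ∃ j ∈ J, dist i j ≤ R}

variable {σ : I → Type v} [∀ i, Fintype (σ i)]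

/-- A `*`-automorphism is an `R`-QCA if it maps every operator supported on `J` to an operator
supported on the radius `R` neighborhood of `J`. -/
def IsQCA (R : ℝ) (α : Aut σ) : Prop :=
  ∀ (J : Set I) (O : LocalAlgebra σ), SupportedOn O J → SupportedOn (α O) (neighborhood R J)

variable (σ) in
/-- One round of a circuit: a collection of pairwise disjoint sets of sites of diameter at
most `r`, and for each set `S` of the collection a unitary (a gate) supported on `S`. -/
structure Round (r : ℝ) where
  sets : Set (Set I)
  disjoint : sets.PairwiseDisjoint id
  diam_le : ∀ S ∈ sets, ∀ i ∈ S, ∀ j ∈ S, dist i j ≤ r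
  gate : Set I → LocalAlgebra σ
  gate_unitary : ∀ S ∈ sets, gate S ∈ unitary (LocalAlgebra σ)
  gate_supported : ∀ S ∈ sets, SupportedOn (gate S) S

/-- The round acts on local operators as `γ`. There may be infinitely many gates; an operator `O`
supported on `J` is conjugated by the product of any finite list of distinct gates that contains
every gate whose set meets `J`. -/
def Round.Implements {r : ℝ} (L : Round σ r) (γ : Aut σ) : Prop :=
  ∀ (J : Set I) (O : LocalAlgebra σ), SupportedOn O J →
    ∀ l : List (Set I), l.Nodup → (∀ S ∈ l, S ∈ L.sets) →
      (∀ S ∈ L.sets, (S ∩ J).Nonempty → S ∈ l) →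
      γ O = (l.map L.gate).prod * O * star (l.map L.gate).prod

/-- The sequence of rounds (first round first) acts on local operators as `γ`. -/
def ImplementsRounds {r : ℝ} : List (Round σ r) → Aut σ → Prop
  | [], γ => γ = 1
  | L :: Ls, γ => ∃ γ₁ γ₂ : Aut σ, L.Implements γ₁ ∧ ImplementsRounds Ls γ₂ ∧ γ = γ₂ * γ₁

variable (σ) in
/-- A quantum circuit: at least one round of gates, all of diameter at most `gateRange`. -/
structure Circuit where
  gateRange : ℝ
  gateRange_nonneg : 0 ≤ gateRange
  rounds : List (Round σ gateRange)
  rounds_ne_nil : rounds ≠ []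

/-- The depth is the number of rounds. -/
def Circuit.depth (C : Circuit σ) : ℕ := C.rounds.length

/-- The range of a circuit is the range of its gates times the number of rounds. -/
def Circuit.range (C : Circuit σ) : ℝ := C.gateRange * C.depth

/-- The circuit acts on local operators by conjugation as the automorphism `γ`. -/
def Circuit.Implements (C : Circuit σ) (γ : Aut σ) : Prop := ImplementsRounds C.rounds γ

end Locality

section Subgroups

variable {I : Type u} [PseudoMetricSpace I] {σ : I → Type v} [∀ i, Fintype (σ i)]

theorem supportedOn_list_prod {r : ℝ} (L : Round σ r) (l : List (Set I))
    (hl : ∀ S ∈ l, S ∈ L.sets) : SupportedOn (l.map L.gate).prod (⋃ S ∈ l, S) := by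
  induction l with
  | nil => simpa using supportedOn_one _
  | cons S l ih =>
    rw [List.map_cons, List.prod_cons]
    refine SupportedOn.mul ((L.gate_supported S (hl S (by simp))).mono ?_)
      ((ih fun T hT => hl T (by simp [hT])).mono ?_)
    · intro i hi; simp [hi]
    · intro i hi
      simp only [Set.mem_iUnion] at hi ⊢
      obtain ⟨T, hT, hi⟩ := hi
      exact ⟨T, by simp [hT], hi⟩

theorem list_prod_unitary {r : ℝ} (L : Round σ r) (l : List (Set I))
    (hl : ∀ S ∈ l, S ∈ L.sets) : (l.map L.gate).prod ∈ unitary (LocalAlgebra σ) := by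
  refine list_prod_mem fun U hU => ?_
  obtain ⟨S, hS, rfl⟩ := List.mem_map.1 hU
  exact L.gate_unitary S (hl S hS)

/-- The round with the inverse gates. -/
def Round.inv {r : ℝ} (L : Round σ r) : Round σ r where
  sets := L.sets
  disjoint := L.disjoint
  diam_le := L.diam_le
  gate := fun S => star (L.gate S)
  gate_unitary := fun S hS => Unitary.star_mem (L.gate_unitary S hS)
  gate_supported := fun S hS => (L.gate_supported S hS).star

/-- The same round with a larger bound on the diameter of the gates. -/
def Round.relax {r r' : ℝ} (h : r ≤ r') (L : Round σ r) : Round σ r' where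
  sets := L.sets
  disjoint := L.disjoint
  diam_le := fun S hS i hi j hj => (L.diam_le S hS i hi j hj).trans h
  gate := L.gate
  gate_unitary := L.gate_unitary
  gate_supported := L.gate_supported

theorem Round.implements_inv {r : ℝ} {L : Round σ r} {γ : Aut σ} (h : L.Implements γ) :
    L.inv.Implements γ⁻¹ := by
  intro J O hO l hnd hl hcov
  have hP : (l.map L.inv.gate).prod = star (l.reverse.map L.gate).prod := by
    clear hnd hl hcov
    induction l with
    | nil => simp
    | cons S l ih =>
      rw [List.map_cons, List.prod_cons, ih, List.reverse_cons, List.map_append, List.prod_append,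
        star_mul]
      simp [Round.inv]
  have hlr : ∀ S ∈ l.reverse, S ∈ L.sets := fun S hS => hl S (List.mem_reverse.1 hS)
  set P := (l.reverse.map L.gate).prod with hPdef
  have hPu : P ∈ unitary (LocalAlgebra σ) := list_prod_unitary L _ hlr
  have hPs : SupportedOn P (⋃ S ∈ l.reverse, S) := supportedOn_list_prod L _ hlr
  have hsup : SupportedOn (star P * O * P) (J ∪ ⋃ S ∈ l.reverse, S) :=
    ((hPs.star.mono Set.subset_union_right).mul (hO.mono Set.subset_union_left)).mul
      (hPs.mono Set.subset_union_right)
  have key := h _ _ hsup l.reverse (List.nodup_reverse.2 hnd) hlr (by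
    intro S hS hne
    rw [List.mem_reverse]
    obtain ⟨i, hiS, hi | hi⟩ := hne
    · exact hcov S hS ⟨i, hiS, hi⟩
    · simp only [Set.mem_iUnion, List.mem_reverse] at hi
      obtain ⟨T, hT, hiT⟩ := hi
      have : S = T := by
        by_contra hST
        exact Set.disjoint_left.1 (L.disjoint hS (hl T hT) hST) hiS hiT
      exact this ▸ hT)
  have h1 : P * star P = 1 := Unitary.mul_star_self_of_mem hPu
  have h2 : γ (star P * O * P) = O := by
    rw [key, ← hPdef]
    calc P * (star P * O * P) * star P = (P * star P) * O * (P * star P) := by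
          simp only [mul_assoc]
      _ = O := by rw [h1]; simp
  rw [hP, star_star]
  calc γ⁻¹ O = γ⁻¹ (γ (star P * O * P)) := by rw [h2]
    _ = star P * O * P := γ.symm_apply_apply _

theorem implementsRounds_append {r : ℝ} {Ls Ms : List (Round σ r)} {γ δ : Aut σ}
    (h : ImplementsRounds Ls γ) (h' : ImplementsRounds Ms δ) :
    ImplementsRounds (Ls ++ Ms) (δ * γ) := by
  induction Ls generalizing γ with
  | nil => simpa [show γ = 1 from h] using h'
  | cons L Ls ih =>
    obtain ⟨γ₁, γ₂, h1, h2, rfl⟩ := h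
    exact ⟨γ₁, δ * γ₂, h1, ih h2, (mul_assoc _ _ _).symm⟩

theorem implementsRounds_relax {r r' : ℝ} (hr : r ≤ r') {Ls : List (Round σ r)} {γ : Aut σ}
    (h : ImplementsRounds Ls γ) : ImplementsRounds (Ls.map (Round.relax hr)) γ := by
  induction Ls generalizing γ with
  | nil => exact h
  | cons L Ls ih =>
    obtain ⟨γ₁, γ₂, h1, h2, rfl⟩ := h
    exact ⟨γ₁, γ₂, h1, ih h2, rfl⟩

theorem implementsRounds_inv {r : ℝ} {Ls : List (Round σ r)} {γ : Aut σ}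
    (h : ImplementsRounds Ls γ) : ImplementsRounds (Ls.map Round.inv).reverse γ⁻¹ := by
  induction Ls generalizing γ with
  | nil => simp [ImplementsRounds, show γ = 1 from h]
  | cons L Ls ih =>
    obtain ⟨γ₁, γ₂, h1, h2, rfl⟩ := h
    rw [List.map_cons, List.reverse_cons, mul_inv_rev]
    exact implementsRounds_append (ih h2) ⟨γ₁⁻¹, 1, Round.implements_inv h1, rfl, by simp⟩

variable (σ)

/-- The round without gates. -/
def Round.empty (r : ℝ) : Round σ r where
  sets := ∅
  disjoint := by simp
  diam_le := by simp
  gate := fun _ => 1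
  gate_unitary := by simp
  gate_supported := by simp

/-- The group of automorphisms that are equal to a quantum circuit. -/
def circuitGroup : Subgroup (Aut σ) where
  carrier := {γ | ∃ C : Circuit σ, C.Implements γ}
  one_mem' := by
    refine ⟨⟨0, le_rfl, [Round.empty σ 0], by simp⟩, 1, 1, ?_, rfl, by simp⟩
    intro J O _ l _ hl _
    have : l = [] := List.eq_nil_iff_forall_not_mem.2 fun S hS => hl S hS
    subst this
    simp
  mul_mem' := by
    rintro γ δ ⟨C, hC⟩ ⟨C', hC'⟩
    refine ⟨⟨max C.gateRange C'.gateRange, le_max_of_le_left C.gateRange_nonneg,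
      C'.rounds.map (Round.relax (le_max_right _ _)) ++
        C.rounds.map (Round.relax (le_max_left _ _)), ?_⟩, ?_⟩
    · simp [C.rounds_ne_nil]
    · exact implementsRounds_append (implementsRounds_relax _ hC') (implementsRounds_relax _ hC)
  inv_mem' := by
    rintro γ ⟨C, hC⟩
    exact ⟨⟨C.gateRange, C.gateRange_nonneg, (C.rounds.map Round.inv).reverse,
      by simp [C.rounds_ne_nil]⟩, implementsRounds_inv hC⟩

/-- The group of QCA of arbitrary finite range, i.e. the group generated by all `R`-QCA. -/
def qcaGroup : Subgroup (Aut σ) := Subgroup.closure {α | ∃ R : ℝ, 0 < R ∧ IsQCA R α}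

/-- QCA modulo circuits is an abelian group: the circuits are a normal subgroup of the group
of QCA, and the quotient is commutative. -/
def QCAModCircuitsIsAbelian : Prop :=
  ∃ _ : ((circuitGroup σ).subgroupOf (qcaGroup σ)).Normal,
    ∀ x y : qcaGroup σ ⧸ (circuitGroup σ).subgroupOf (qcaGroup σ), x * y = y * x

end Subgroups

section Qudits

variable {I : Type u}

/-- Basis labels of the site Hilbert spaces when site `i` hosts `n i` qudits of dimension `q`. -/
abbrev quditBasis (n : I → ℕ) (q : ℕ) : I → Type := fun i => Fin (n i) → Fin q

/-- The density assumption with constants `c, c', d` at all length scales `1 ≤ ℓ ≤ ℓ₀`, for a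
system in which site `i` hosts `phys i` physical and `anc i` ancilla qudits: every ball of
radius `ℓ` contains at least `⌊c ℓ^d⌋` physical qudits, and every shell of radii `[ℓ - 1, ℓ]`
contains at most `⌊c' ℓ^(d-1)⌋` ancilla qudits. -/
def DensityAssumption [PseudoMetricSpace I] (phys anc : I → ℕ) (c c' d ℓ₀ : ℝ) : Prop :=
  ∀ (x : I) (ℓ : ℝ), 1 ≤ ℓ → ℓ ≤ ℓ₀ →
    ((⌊c * ℓ ^ d⌋₊ : ℕ) : ℕ∞) ≤ {p : Σ i, Fin (phys i) | dist x p.1 ≤ ℓ}.encard ∧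
    {p : Σ i, Fin (anc i) | ℓ - 1 ≤ dist x p.1 ∧ dist x p.1 ≤ ℓ}.encard
      ≤ ((⌊c' * ℓ ^ (d - 1)⌋₊ : ℕ) : ℕ∞)

end Qudits

end QCA

end

/-! Let γ = αβα⁻¹β⁻¹, and let S exchange the two factors of the doubled algebra A ⊗ A. Since S(α⁻¹ ⊗
1)S = 1 ⊗ α⁻¹, the automorphism γ ⊗ 1 is a word in α^{±1} ⊗ 1, β^{±1} ⊗ 1 and four copies of S,
while the same word with every S deleted is 1. With the swaps restricted to a set Y of sites, this
word (`commutatorOn`) is local, equals γ ⊗ 1 deep inside Y and equals 1 far from Y. Enlarging Y by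
balls thus factors γ ⊗ 1 into a circuit that uses the second copy as ancillas.

To avoid ancillas, note that the second copy of a qudit is moved only if the qudit is close to the
boundary of Y. Keep Y away from the balls around a sparse set `N₀` of centres. At a large scale ℓ
volume beats surface (`exists_scale`), so the set `D` of qudits near boundaries injects, by a map
`j` of bounded displacement, into the interiors of these balls (`exists_covering`). Conjugation by
the exchange of the second copy of each p in `D` with the first copy of `j p` turns the word into an
automorphism that fixes the whole second copy. It therefore restricts to an automorphism v_Y of the
original system (`exists_interpolation`).

Colour the balls of radius ℓ with boundedly many colours so that balls of one colour are far apart,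
and let V_k be v_Y for the union of the balls of the first k colours minus the balls around `N₀`.
Then V_{k+1}V_k⁻¹ acts separately on disjoint enlarged balls of one colour. After the last colour, V
agrees with γ except near the balls around `N₀`, so γV⁻¹ acts separately on disjoint balls too
(`exists_blockwise_factorization`). By Skolem-Noether an automorphism of a finite block is
conjugation by a unitary, so each factor is one round (`exists_gates`).

Supports are controlled throughout by the commutant criterion `IsMatrixUnits.mem_net_iff`. The
statement about groups follows formally once all commutators of QCA are circuits. -/

noncomputable section

namespace QCA

/-! ### Commuting systems of matrix units and the algebras they generate. -/

section MatrixUnits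

variable {P κ A B : Type*} [Fintype κ] [DecidableEq κ]
  [Ring A] [StarRing A] [Algebra ℂ A] [Ring B] [StarRing B] [Algebra ℂ B]

/-- Mutually commuting systems of matrix units, one for each `p : P`. -/
structure IsMatrixUnits (e : P → κ → κ → A) : Prop where
  mul_self : ∀ p a b c d, e p a b * e p c d = if b = c then e p a d else 0
  sum_diag : ∀ p, ∑ a, e p a a = 1
  commute : ∀ p p', p ≠ p' → ∀ a b c d, Commute (e p a b) (e p' c d)
  star_eq : ∀ p a b, star (e p a b) = e p b a

/-- The algebra generated by the matrix units with labels in `K`. -/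
def net (e : P → κ → κ → A) (K : Set P) : Subalgebra ℂ A :=
  Algebra.adjoin ℂ {x | ∃ p ∈ K, ∃ a b, x = e p a b}

section Net

variable {e : P → κ → κ → A}

omit [Fintype κ] [DecidableEq κ] [StarRing A] in
theorem unit_mem_net {K : Set P} {p : P} (hp : p ∈ K) (a b : κ) : e p a b ∈ net e K :=
  Algebra.subset_adjoin ⟨p, hp, a, b, rfl⟩

omit [Fintype κ] [DecidableEq κ] [StarRing A] in
theorem net_le {K : Set P} {S : Subalgebra ℂ A} (h : ∀ p ∈ K, ∀ a b, e p a b ∈ S) :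
    net e K ≤ S := by
  refine Algebra.adjoin_le ?_
  rintro _ ⟨p, hp, a, b, rfl⟩
  exact h p hp a b

omit [Fintype κ] [DecidableEq κ] [StarRing A] in
theorem net_mono {K L : Set P} (h : K ⊆ L) : net e K ≤ net e L :=
  net_le fun _ hp a b => unit_mem_net (h hp) a b

omit [Fintype κ] [DecidableEq κ] [StarRing A] in
theorem commute_of_forall_unit {K : Set P} {x y : A} (hx : x ∈ net e K)
    (h : ∀ p ∈ K, ∀ a b, Commute y (e p a b)) : Commute y x := by
  have h1 : net e K ≤ Subalgebra.centralizer ℂ {y} := net_le fun p hp a b => by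
    rw [Subalgebra.mem_centralizer_iff]
    rintro _ rfl
    exact h p hp a b
  exact (Subalgebra.mem_centralizer_iff ℂ).1 (h1 hx) y rfl

theorem IsMatrixUnits.commute_of_disjoint (he : IsMatrixUnits e) {K L : Set P}
    (hKL : Disjoint K L) {x y : A} (hx : x ∈ net e K) (hy : y ∈ net e L) : Commute x y := by
  refine commute_of_forall_unit hy fun p hp a b => (commute_of_forall_unit hx ?_).symm
  intro p' hp' c d
  refine he.commute _ _ ?_ _ _ _ _
  rintro rfl
  exact Set.disjoint_left.1 hKL hp' hp

-- Each element is a polynomial in finitely many generators; this is what allows induction over the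
-- qudits of an infinite system.
omit [Fintype κ] [DecidableEq κ] [StarRing A] in
theorem exists_finset_of_mem_net {K : Set P} {x : A} (hx : x ∈ net e K) :
    ∃ F : Finset P, (F : Set P) ⊆ K ∧ x ∈ net e (F : Set P) := by
  classical
  have key : ∀ x y (F G : Finset P), x ∈ net e (F : Set P) → y ∈ net e (G : Set P) →
      x ∈ net e (↑(F ∪ G) : Set P) ∧ y ∈ net e (↑(F ∪ G) : Set P) := fun x y F G hx hy =>
    ⟨net_mono (by simp) hx, net_mono (by simp) hy⟩
  induction hx using Algebra.adjoin_induction with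
  | mem x hx =>
    obtain ⟨p, hp, a, b, rfl⟩ := hx
    exact ⟨{p}, by simpa using hp, unit_mem_net (by simp) a b⟩
  | algebraMap r => exact ⟨∅, by simp, Subalgebra.algebraMap_mem _ _⟩
  | add x y _ _ ihx ihy =>
    obtain ⟨F, hF, hx⟩ := ihx
    obtain ⟨G, hG, hy⟩ := ihy
    have := key x y F G hx hy
    exact ⟨F ∪ G, by simp [hF, hG], add_mem this.1 this.2⟩
  | mul x y _ _ ihx ihy =>
    obtain ⟨F, hF, hx⟩ := ihx
    obtain ⟨G, hG, hy⟩ := ihy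
    have := key x y F G hx hy
    exact ⟨F ∪ G, by simp [hF, hG], mul_mem this.1 this.2⟩

/-- Expansion of an operator in the matrix units at `p`. -/
theorem IsMatrixUnits.exists_expansion (he : IsMatrixUnits e) (p : P) {L : Set P} {x : A}
    (hx : x ∈ net e L) :
    ∃ y : κ → κ → A, (∀ a b, y a b ∈ net e (L \ {p})) ∧ x = ∑ a, ∑ b, e p a b * y a b := by
  have hcomm : ∀ a b, ∀ y ∈ net e (L \ {p}), Commute (e p a b) y := fun a b y hy =>
    he.commute_of_disjoint (K := {p}) (by simp) (unit_mem_net (Set.mem_singleton p) a b) hy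
  have hscal : ∀ z ∈ net e (L \ {p}),
      ∃ y : κ → κ → A, (∀ a b, y a b ∈ net e (L \ {p})) ∧ z = ∑ a, ∑ b, e p a b * y a b := by
    intro z hz
    refine ⟨fun a b => if a = b then z else 0, fun a b => ?_, ?_⟩
    · by_cases h : a = b
      · simpa [h] using hz
      · simp [h]
    · simp [← Finset.sum_mul, he.sum_diag]
  induction hx using Algebra.adjoin_induction with
  | mem x hx =>
    obtain ⟨p', hp', c, d, rfl⟩ := hx
    by_cases h : p' = p
    · subst h
      refine ⟨fun a b => if a = c ∧ b = d then 1 else 0, fun a b => ?_, ?_⟩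
      · dsimp only
        split_ifs
        · exact one_mem _
        · exact zero_mem _
      · rw [Finset.sum_eq_single c, Finset.sum_eq_single d] <;> simp +contextual
    · exact hscal _ (unit_mem_net (show p' ∈ L \ {p} from ⟨hp', h⟩) c d)
  | algebraMap r => exact hscal _ (Subalgebra.algebraMap_mem _ _)
  | add x y _ _ ihx ihy =>
    obtain ⟨u, hu, rfl⟩ := ihx
    obtain ⟨v, hv, rfl⟩ := ihy
    exact ⟨fun a b => u a b + v a b, fun a b => add_mem (hu a b) (hv a b), by
      simp only [mul_add, Finset.sum_add_distrib]⟩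
  | mul x y _ _ ihx ihy =>
    obtain ⟨u, hu, rfl⟩ := ihx
    obtain ⟨v, hv, rfl⟩ := ihy
    refine ⟨fun a b => ∑ c, u a c * v c b,
      fun a b => sum_mem fun c _ => mul_mem (hu a c) (hv c b), ?_⟩
    have hmul : ∀ a b c d, e p a b * u a b * (e p c d * v c d)
        = if c = b then e p a d * (u a c * v c d) else 0 := by
      intro a b c d
      rw [mul_assoc, ← mul_assoc (u a b), ← (hcomm c d _ (hu a b)).eq, mul_assoc, ← mul_assoc,
        he.mul_self]
      by_cases h : c = b
      · simp [h]
      · simp [h, Ne.symm h]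
    rw [Finset.sum_mul]
    refine Finset.sum_congr rfl fun a _ => ?_
    simp only [Finset.sum_mul, Finset.mul_sum, hmul]
    rw [Finset.sum_comm]
    refine (Finset.sum_congr rfl fun c _ => Finset.sum_comm).trans ?_
    refine Finset.sum_congr rfl fun d _ => Finset.sum_congr rfl fun c _ => ?_
    simp

/-- Sandwiching between `e p c a` and `e p b c` kills all coefficients but one and leaves `e p c c *
y a b`; the diagonal units sum to 1. So the coefficients lie in the two-sided ideal generated by the
expanded operator. -/
theorem IsMatrixUnits.coeff_eq (he : IsMatrixUnits e) {p : P} {L : Set P} (hp : p ∉ L)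
    {y : κ → κ → A} (hy : ∀ a b, y a b ∈ net e L) (a b : κ) :
    ∑ c, e p c a * (∑ a', ∑ b', e p a' b' * y a' b') * e p b c = y a b := by
  have hcomm : ∀ a b, ∀ y ∈ net e L, Commute (e p a b) y := fun a b y hy =>
    he.commute_of_disjoint (K := {p}) (by simpa using hp) (unit_mem_net (Set.mem_singleton p) a b) hy
  have : ∀ c, e p c a * (∑ a', ∑ b', e p a' b' * y a' b') * e p b c = e p c c * y a b := by
    intro c
    simp only [Finset.mul_sum, Finset.sum_mul]
    have h1 : ∀ a' b', e p c a * (e p a' b' * y a' b') * e p b c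
        = if a = a' then (if b' = b then e p c c * y a b else 0) else 0 := by
      intro a' b'
      rw [mul_assoc, mul_assoc, ← (hcomm b c _ (hy a' b')).eq, ← mul_assoc, ← mul_assoc,
        he.mul_self]
      split_ifs with h h'
      · rw [he.mul_self, if_pos h', h, h']
      · rw [he.mul_self, if_neg h', zero_mul]
      · simp
    simp [h1]
  simp only [this, ← Finset.sum_mul, he.sum_diag, one_mul]

/-- The sum of `e p c o * x * e p o c` over c is x itself, because x commutes with the units at p,
and it is also a coefficient of the expansion of x at p. -/
theorem IsMatrixUnits.mem_net_diff_singleton [Nonempty κ] (he : IsMatrixUnits e) {p : P}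
    {L : Set P} {x : A} (hx : x ∈ net e L) (hc : ∀ a b, Commute x (e p a b)) :
    x ∈ net e (L \ {p}) := by
  obtain ⟨y, hy, hxy⟩ := he.exists_expansion p hx
  obtain ⟨o⟩ := ‹Nonempty κ›
  have h := he.coeff_eq (p := p) (L := L \ {p}) (by simp) hy o o
  rw [← hxy] at h
  have h2 : ∑ c, e p c o * x * e p o c = x := by
    have : ∀ c, e p c o * x * e p o c = e p c c * x := fun c => by
      rw [mul_assoc, (hc o c).eq, ← mul_assoc, he.mul_self, if_pos rfl]
    simp only [this, ← Finset.sum_mul, he.sum_diag, one_mul]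
  rw [← h2, h]
  exact hy o o

/-- The commutant of the matrix units outside of `K` is the algebra on `K`. -/
theorem IsMatrixUnits.mem_net_iff [Nonempty κ] (he : IsMatrixUnits e)
    (hgen : net e Set.univ = ⊤) {K : Set P} {x : A} :
    x ∈ net e K ↔ ∀ p ∉ K, ∀ a b, Commute x (e p a b) := by
  classical
  refine ⟨fun hx p hp a b =>
    he.commute_of_disjoint (by simpa using hp) hx (unit_mem_net (Set.mem_singleton p) a b), ?_⟩
  intro h
  obtain ⟨F, -, hF⟩ := exists_finset_of_mem_net (e := e) (K := Set.univ) (x := x)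
    (by rw [hgen]; trivial)
  -- The qudits of the finite support that lie outside K are removed one at a time.
  have : ∀ G : Finset P, (∀ p ∈ G, p ∉ K) → x ∈ net e ((F : Set P) \ G) := by
    intro G
    induction G using Finset.induction_on with
    | empty => intro _; simpa using hF
    | insert p G _ ih =>
      intro hG
      have h1 := he.mem_net_diff_singleton (p := p)
        (ih fun p hp => hG p (Finset.mem_insert_of_mem hp)) (h p (hG p (by simp)))
      refine net_mono ?_ h1
      intro i
      simp only [Set.mem_sdiff, Set.mem_singleton_iff, Finset.coe_insert, Set.mem_insert_iff]
      tauto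
  refine net_mono ?_ (this (F.filter (· ∉ K)) (by simp))
  intro i
  simp +contextual

omit [StarRing B] in
/-- The local algebras have no nontrivial ideals. -/
theorem IsMatrixUnits.eq_zero_of_map_eq_zero (he : IsMatrixUnits e) [Nontrivial B]
    (φ : A →ₐ[ℂ] B) {x : A} (hx : x ∈ net e Set.univ) (h : φ x = 0) : x = 0 := by
  classical
  obtain ⟨F, -, hF⟩ := exists_finset_of_mem_net hx
  clear hx
  induction F using Finset.induction_on generalizing x with
  | empty =>
    have : net e ((∅ : Finset P) : Set P) = ⊥ := by simp [net]
    rw [this, Algebra.mem_bot] at hF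
    obtain ⟨r, rfl⟩ := hF
    rw [AlgHom.commutes] at h
    rw [(map_eq_zero_iff _ (algebraMap ℂ B).injective).1 h, map_zero]
  | insert p F hp ih =>
    obtain ⟨y, hy, hxy⟩ := he.exists_expansion p hF
    have hy' : ∀ a b, y a b ∈ net e (F : Set P) := fun a b => net_mono (by simp) (hy a b)
    -- The coefficients are sums of sandwiches of x, so φ kills them as well, and they live on one
    -- qudit fewer.
    have : ∀ a b, y a b = 0 := by
      intro a b
      refine ih ?_ (hy' a b)
      rw [← he.coeff_eq (p := p) (L := F) (by simpa using hp) hy' a b, ← hxy]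
      simp [h]
    simp [hxy, this]

omit [StarRing B] in
theorem IsMatrixUnits.injective (he : IsMatrixUnits e) (hgen : net e Set.univ = ⊤) [Nontrivial B]
    (φ : A →ₐ[ℂ] B) : Function.Injective φ :=
  (injective_iff_map_eq_zero φ).2 fun _ h =>
    he.eq_zero_of_map_eq_zero φ (by rw [hgen]; trivial) h

omit [Fintype κ] [DecidableEq κ] [StarRing A] [StarRing B] in
theorem map_mem_of_forall_unit {F : Type*} [FunLike F A B] [AlgHomClass F ℂ A B] (φ : F)
    {K : Set P} {S : Subalgebra ℂ B} (h : ∀ p ∈ K, ∀ a b, φ (e p a b) ∈ S) {x : A}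
    (hx : x ∈ net e K) : φ x ∈ S := by
  have : net e K ≤ S.comap (AlgHomClass.toAlgHom φ : A →ₐ[ℂ] B) := net_le h
  exact this hx

omit [Fintype κ] [DecidableEq κ] [StarRing A] [StarRing B] in
theorem eq_of_mem_net {F G : Type*} [FunLike F A B] [AlgHomClass F ℂ A B] [FunLike G A B]
    [AlgHomClass G ℂ A B] (φ : F) (ψ : G) {K : Set P}
    (h : ∀ p ∈ K, ∀ a b, φ (e p a b) = ψ (e p a b)) {x : A} (hx : x ∈ net e K) :
    φ x = ψ x := by
  have : net e K ≤ AlgHom.equalizer (AlgHomClass.toAlgHom φ : A →ₐ[ℂ] B) (AlgHomClass.toAlgHom ψ : A →ₐ[ℂ] B) := net_le h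
  exact this hx

end Net

/-- Universal property of an algebra generated by matrix units. -/
theorem IsMatrixUnits.exists_lift [StarModule ℂ A] [StarModule ℂ B] [Nontrivial A]
    {e : P → κ → κ → A} (he : IsMatrixUnits e)
    (hgen : net e Set.univ = ⊤) {f : P → κ → κ → B} (hf : IsMatrixUnits f) :
    ∃ φ : A →⋆ₐ[ℂ] B, ∀ p a b, φ (e p a b) = f p a b := by
  -- The pairs generate the graph of the desired map. Its projection to A is injective because there
  -- are no nontrivial ideals, and surjective because e generates A.
  let g : P → κ → κ → A × B := fun p a b => (e p a b, f p a b)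
  have hg : IsMatrixUnits g :=
    { mul_self := fun p a b c d => by
        have h1 := he.mul_self p a b c d
        have h2 := hf.mul_self p a b c d
        ext <;> simp only [g, Prod.mk_mul_mk, h1, h2] <;> split_ifs <;> rfl
      sum_diag := fun p => by
        ext <;> simp [g, Prod.fst_sum, Prod.snd_sum, he.sum_diag, hf.sum_diag]
      commute := fun p p' h a b c d => (he.commute p p' h a b c d).prod (hf.commute p p' h a b c d)
      star_eq := fun p a b => by
        ext <;> simp [g, he.star_eq, hf.star_eq] }
  let G := net g Set.univ
  let π₁ : G →ₐ[ℂ] A := (AlgHom.fst ℂ A B).comp G.val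
  let π₂ : G →ₐ[ℂ] B := (AlgHom.snd ℂ A B).comp G.val
  have hinj : Function.Injective π₁ := by
    refine (injective_iff_map_eq_zero π₁).2 fun x hx => Subtype.ext ?_
    exact hg.eq_zero_of_map_eq_zero (AlgHom.fst ℂ A B) x.2 hx
  have hsurj : Function.Surjective π₁ := by
    have : net e Set.univ ≤ π₁.range := net_le fun p _ a b =>
      ⟨⟨g p a b, unit_mem_net (Set.mem_univ p) a b⟩, rfl⟩
    intro x
    exact this (by rw [hgen]; trivial)
  let ε : G ≃ₐ[ℂ] A := AlgEquiv.ofBijective π₁ ⟨hinj, hsurj⟩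
  let φ : A →ₐ[ℂ] B := π₂.comp (ε.symm : A →ₐ[ℂ] G)
  have hφ : ∀ p a b, φ (e p a b) = f p a b := fun p a b => by
    have : ε ⟨g p a b, unit_mem_net (Set.mem_univ p) a b⟩ = e p a b := rfl
    change π₂ (ε.symm (e p a b)) = _
    rw [← this, AlgEquiv.symm_apply_apply]
    rfl
  refine ⟨{ φ with map_star' := fun x => ?_ }, hφ⟩
  change φ (star x) = star (φ x)
  have hx : x ∈ net e Set.univ := by rw [hgen]; trivial
  induction hx using Algebra.adjoin_induction with
  | mem x hx =>
    obtain ⟨p, -, a, b, rfl⟩ := hx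
    rw [he.star_eq, hφ, hφ, hf.star_eq]
  | algebraMap r => rw [← algebraMap_star_comm, AlgHom.commutes, AlgHom.commutes,
      algebraMap_star_comm]
  | add x y _ _ ihx ihy => simp [ihx, ihy]
  | mul x y _ _ ihx ihy => simp [ihx, ihy]

end MatrixUnits

/-! ### Algebras generated by qudits, and their homomorphisms. -/

section QuditAlgebra

variable {P κ A B : Type*} [Fintype κ] [DecidableEq κ]
  [Ring A] [StarRing A] [Algebra ℂ A] [Ring B] [StarRing B] [Algebra ℂ B]

theorem IsMatrixUnits.map {e : P → κ → κ → A} (he : IsMatrixUnits e) (φ : A →⋆ₐ[ℂ] B) :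
    IsMatrixUnits (fun p a b => φ (e p a b)) where
  mul_self p a b c d := by
    rw [← map_mul, he.mul_self]
    split_ifs <;> simp
  sum_diag p := by rw [← map_sum, he.sum_diag, map_one]
  commute p p' h a b c d := (he.commute p p' h a b c d).map φ
  star_eq p a b := by rw [← map_star, he.star_eq]

omit [Algebra ℂ A] in
theorem IsMatrixUnits.comp {Q : Type*} {e : P → κ → κ → A} (he : IsMatrixUnits e) {τ : Q → P}
    (hτ : Function.Injective τ) : IsMatrixUnits (fun p => e (τ p)) where
  mul_self _ := he.mul_self _
  sum_diag _ := he.sum_diag _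
  commute _ _ h := he.commute _ _ (hτ.ne h)
  star_eq _ := he.star_eq _

omit [Algebra ℂ A] in
theorem IsMatrixUnits.sumElim {Q : Type*} {e : P → κ → κ → A} {f : Q → κ → κ → A}
    (he : IsMatrixUnits e) (hf : IsMatrixUnits f)
    (h : ∀ p p' a b c d, Commute (e p a b) (f p' c d)) : IsMatrixUnits (Sum.elim e f) where
  mul_self := by rintro (p | p); exacts [he.mul_self p, hf.mul_self p]
  sum_diag := by rintro (p | p); exacts [he.sum_diag p, hf.sum_diag p]
  commute := by
    rintro (p | p) (p' | p') hp a b c d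
    · exact he.commute _ _ (fun h => hp (by rw [h])) _ _ _ _
    · exact h _ _ _ _ _ _
    · exact (h _ _ _ _ _ _).symm
    · exact hf.commute _ _ (fun h => hp (by rw [h])) _ _ _ _
  star_eq := by rintro (p | p); exacts [he.star_eq p, hf.star_eq p]

/-- The matrix units `e` generate the algebra, which is then the algebraic tensor product of
the matrix algebras of the qudits `p : P`. -/
structure IsQuditAlgebra (e : P → κ → κ → A) : Prop where
  units : IsMatrixUnits e
  gen : net e Set.univ = ⊤

variable {e : P → κ → κ → A}

theorem IsQuditAlgebra.mem_univ (he : IsQuditAlgebra e) (x : A) : x ∈ net e Set.univ := by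
  rw [he.gen]; trivial

omit [StarRing B] in
theorem IsQuditAlgebra.hom_ext (he : IsQuditAlgebra e) {F G : Type*} [FunLike F A B]
    [AlgHomClass F ℂ A B] [FunLike G A B] [AlgHomClass G ℂ A B] (φ : F) (ψ : G)
    (h : ∀ p a b, φ (e p a b) = ψ (e p a b)) (x : A) : φ x = ψ x :=
  eq_of_mem_net φ ψ (K := Set.univ) (fun p _ => h p) (he.mem_univ x)

theorem IsQuditAlgebra.mem_net_iff [Nonempty κ] (he : IsQuditAlgebra e) {K : Set P} {x : A} :
    x ∈ net e K ↔ ∀ p ∉ K, ∀ a b, Commute x (e p a b) :=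
  he.units.mem_net_iff he.gen

omit [StarRing B] in
theorem IsQuditAlgebra.injective (he : IsQuditAlgebra e) [Nontrivial B] {F : Type*}
    [FunLike F A B] [AlgHomClass F ℂ A B] (φ : F) : Function.Injective φ :=
  he.units.injective he.gen (AlgHomClass.toAlgHom φ : A →ₐ[ℂ] B)

section Lift

variable [StarModule ℂ A] [StarModule ℂ B] [Nontrivial A]

/-- The homomorphism that maps one system of matrix units to another one. -/
def IsQuditAlgebra.lift (he : IsQuditAlgebra e) {f : P → κ → κ → B} (hf : IsMatrixUnits f) :
    A →⋆ₐ[ℂ] B :=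
  (he.units.exists_lift he.gen hf).choose

@[simp]
theorem IsQuditAlgebra.lift_unit (he : IsQuditAlgebra e) {f : P → κ → κ → B}
    (hf : IsMatrixUnits f) (p : P) (a b : κ) : he.lift hf (e p a b) = f p a b :=
  (he.units.exists_lift he.gen hf).choose_spec p a b

/-- The automorphism that permutes the qudits. -/
def IsQuditAlgebra.perm (he : IsQuditAlgebra e) (τ : Equiv.Perm P) : A ≃⋆ₐ[ℂ] A :=
  StarAlgEquiv.ofStarAlgHom (he.lift (he.units.comp τ.injective))
    (he.lift (he.units.comp τ.symm.injective))
    (StarAlgHom.ext fun x => he.hom_ext _ (StarAlgHom.id ℂ A) (by simp) x)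
    (StarAlgHom.ext fun x => he.hom_ext _ (StarAlgHom.id ℂ A) (by simp) x)

@[simp]
theorem IsQuditAlgebra.perm_unit (he : IsQuditAlgebra e) (τ : Equiv.Perm P) (p : P) (a b : κ) :
    he.perm τ (e p a b) = e (τ p) a b :=
  he.lift_unit (he.units.comp τ.injective) p a b

end Lift

end QuditAlgebra

/-! ### The doubled system A ⊗ A and automorphisms of the form α ⊗ id. -/

section Double

variable {P κ A B : Type*} [Fintype κ] [DecidableEq κ]
  [Ring A] [StarRing A] [Algebra ℂ A] [Ring B] [StarRing B] [Algebra ℂ B]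
  [StarModule ℂ A] [StarModule ℂ B] [Nontrivial A]
  {e : P → κ → κ → A} {E : P ⊕ P → κ → κ → B}

/-- The first tensor factor of the doubled system. -/
def inl (he : IsQuditAlgebra e) (hE : IsQuditAlgebra E) : A →⋆ₐ[ℂ] B :=
  he.lift (hE.units.comp Sum.inl_injective)

/-- The second tensor factor of the doubled system. -/
def inr (he : IsQuditAlgebra e) (hE : IsQuditAlgebra E) : A →⋆ₐ[ℂ] B :=
  he.lift (hE.units.comp Sum.inr_injective)

variable (he : IsQuditAlgebra e) (hE : IsQuditAlgebra E)

@[simp]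
theorem inl_unit (p : P) (a b : κ) : inl he hE (e p a b) = E (Sum.inl p) a b :=
  he.lift_unit _ p a b

@[simp]
theorem inr_unit (p : P) (a b : κ) : inr he hE (e p a b) = E (Sum.inr p) a b :=
  he.lift_unit _ p a b

theorem inl_mem {K : Set P} {x : A} (hx : x ∈ net e K) :
    inl he hE x ∈ net E (Sum.inl '' K) :=
  map_mem_of_forall_unit (inl he hE) (fun p hp a b => by
    rw [inl_unit]; exact unit_mem_net (Set.mem_image_of_mem _ hp) a b) hx

theorem inl_mem_iff [Nontrivial B] [Nonempty κ] {L : Set (P ⊕ P)} {x : A} :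
    inl he hE x ∈ net E L ↔ x ∈ net e (Sum.inl ⁻¹' L) := by
  refine ⟨fun h => ?_, fun h => net_mono (Set.image_preimage_subset _ _) (inl_mem he hE h)⟩
  rw [he.mem_net_iff]
  intro p hp a b
  have := (hE.mem_net_iff.1 h) (Sum.inl p) hp a b
  rw [← inl_unit he hE] at this
  have h2 := this.eq
  rw [← map_mul, ← map_mul] at h2
  exact he.injective (inl he hE) h2

/-- The commutant of the second tensor factor is the first one. -/
theorem exists_inl_eq [Nonempty κ] {y : B} (h : ∀ p a b, Commute y (E (Sum.inr p) a b)) :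
    ∃ x, inl he hE x = y := by
  have h1 : y ∈ net E (Set.range Sum.inl) := by
    rw [hE.mem_net_iff]
    rintro (p | p) hp a b
    · exact absurd ⟨p, rfl⟩ hp
    · exact h p a b
  have h2 : net E (Set.range Sum.inl) ≤ (inl he hE : A →ₐ[ℂ] B).range := by
    refine net_le ?_
    rintro _ ⟨p, rfl⟩ a b
    exact ⟨e p a b, inl_unit he hE p a b⟩
  exact h2 h1

/-- An automorphism of the doubled system that fixes the second factor restricts to
the first factor. -/
theorem exists_restrict [Nontrivial B] [Nonempty κ] (W : B ≃⋆ₐ[ℂ] B)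
    (hW : ∀ p a b, W (E (Sum.inr p) a b) = E (Sum.inr p) a b) :
    ∃ v : A ≃⋆ₐ[ℂ] A, ∀ x, inl he hE (v x) = W (inl he hE x) := by
  have hcomm : ∀ (W : B ≃⋆ₐ[ℂ] B), (∀ p a b, W (E (Sum.inr p) a b) = E (Sum.inr p) a b) →
      ∃ v : A →⋆ₐ[ℂ] A, ∀ x, inl he hE (v x) = W (inl he hE x) := by
    intro W hW
    have h1 : ∀ p a b, ∃ x, inl he hE x = W (E (Sum.inl p) a b) := by
      intro p a b
      -- W fixes the second factor pointwise, so it maps the first factor into the commutant of the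
      -- second.
      refine exists_inl_eq he hE fun p' c d => ?_
      rw [← hW]
      exact (hE.units.commute _ _ (by simp) a b c d).map W
    choose f hf using h1
    have hinj := he.injective (inl he hE)
    have hWm := hE.units.map (W : B →⋆ₐ[ℂ] B)
    have hfm : IsMatrixUnits f :=
      { mul_self := fun p a b c d => hinj (by
          rw [map_mul, hf, hf]
          refine (hWm.mul_self (Sum.inl p) a b c d).trans ?_
          split_ifs
          · exact (hf p a d).symm
          · simp)
        sum_diag := fun p => hinj (by
          rw [map_sum, map_one]
          simp only [hf]
          exact hWm.sum_diag (Sum.inl p))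
        commute := fun p p' h a b c d => hinj (by
          rw [map_mul, map_mul, hf, hf]
          exact hWm.commute _ _ (Sum.inl_injective.ne h) a b c d)
        star_eq := fun p a b => hinj (by
          rw [map_star, hf, hf]
          exact hWm.star_eq (Sum.inl p) a b) }
    refine ⟨he.lift hfm, fun x => ?_⟩
    refine he.hom_ext ((inl he hE).comp (he.lift hfm)) ((W : B →⋆ₐ[ℂ] B).comp (inl he hE)) ?_ x
    intro p a b
    simp [hf]
  obtain ⟨v, hv⟩ := hcomm W hW
  obtain ⟨v', hv'⟩ := hcomm W⁻¹ (fun p a b => by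
    conv_lhs => rw [← hW p a b]
    exact W.symm_apply_apply _)
  have hinj := he.injective (inl he hE)
  refine ⟨StarAlgEquiv.ofStarAlgHom v v' (StarAlgHom.ext fun x => hinj ?_)
    (StarAlgHom.ext fun x => hinj ?_), hv⟩
  · change inl he hE (v' (v x)) = inl he hE x
    rw [hv', hv]
    exact W.symm_apply_apply _
  · change inl he hE (v (v' x)) = inl he hE x
    rw [hv, hv']
    exact W.apply_symm_apply _

theorem amplify_units (α : A ≃⋆ₐ[ℂ] A) : IsMatrixUnits
    (Sum.elim (fun p a b => inl he hE (α (e p a b))) (fun p => E (Sum.inr p))) := by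
  refine IsMatrixUnits.sumElim ((he.units.map (α : A →⋆ₐ[ℂ] A)).map (inl he hE))
    (hE.units.comp Sum.inr_injective) fun p p' a b c d => ?_
  refine hE.units.commute_of_disjoint (K := Sum.inl '' Set.univ) (L := {Sum.inr p'}) (by simp)
    (inl_mem he hE (he.mem_univ _)) (unit_mem_net (Set.mem_singleton _) c d)

variable [Nontrivial B]

/-- The homomorphism `α ⊗ id` of the doubled system. -/
def amplifyHom (α : A ≃⋆ₐ[ℂ] A) : B →⋆ₐ[ℂ] B := hE.lift (amplify_units he hE α)

@[simp]
theorem amplifyHom_inr_unit (α : A ≃⋆ₐ[ℂ] A) (p : P) (a b : κ) :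
    amplifyHom he hE α (E (Sum.inr p) a b) = E (Sum.inr p) a b :=
  hE.lift_unit (amplify_units he hE α) _ a b

@[simp]
theorem amplifyHom_inl (α : A ≃⋆ₐ[ℂ] A) (x : A) :
    amplifyHom he hE α (inl he hE x) = inl he hE (α x) := by
  refine he.hom_ext ((amplifyHom he hE α).comp (inl he hE))
    ((inl he hE).comp (α : A →⋆ₐ[ℂ] A)) (fun p a b => ?_) x
  change amplifyHom he hE α (inl he hE (e p a b)) = inl he hE (α (e p a b))
  rw [inl_unit]
  exact hE.lift_unit (amplify_units he hE α) _ a b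

theorem amplifyHom_comp (α β : A ≃⋆ₐ[ℂ] A) (h : ∀ x, α (β x) = x) :
    (amplifyHom he hE α).comp (amplifyHom he hE β) = StarAlgHom.id ℂ B := by
  refine StarAlgHom.ext fun x => hE.hom_ext _ _ ?_ x
  rintro (p | p) a b
  · rw [← inl_unit he hE]
    change amplifyHom he hE α (amplifyHom he hE β (inl he hE _)) = inl he hE _
    rw [amplifyHom_inl, amplifyHom_inl, h]
  · simp

/-- The automorphism `α ⊗ id` of the doubled system. -/
def amplify (α : A ≃⋆ₐ[ℂ] A) : B ≃⋆ₐ[ℂ] B :=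
  StarAlgEquiv.ofStarAlgHom (amplifyHom he hE α) (amplifyHom he hE α⁻¹)
    (amplifyHom_comp he hE _ _ α.symm_apply_apply) (amplifyHom_comp he hE _ _ α.apply_symm_apply)

@[simp]
theorem amplify_inl (α : A ≃⋆ₐ[ℂ] A) (x : A) :
    amplify he hE α (inl he hE x) = inl he hE (α x) := amplifyHom_inl he hE α x

@[simp]
theorem amplify_inr_unit (α : A ≃⋆ₐ[ℂ] A) (p : P) (a b : κ) :
    amplify he hE α (E (Sum.inr p) a b) = E (Sum.inr p) a b := amplifyHom_inr_unit he hE α p a b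

@[simp]
theorem amplify_inr (α : A ≃⋆ₐ[ℂ] A) (x : A) :
    amplify he hE α (inr he hE x) = inr he hE x := by
  refine he.hom_ext ((amplifyHom he hE α).comp (inr he hE)) (inr he hE) (fun p a b => ?_) x
  simp

theorem amplify_inv (α : A ≃⋆ₐ[ℂ] A) : (amplify he hE α)⁻¹ = amplify he hE α⁻¹ :=
  inv_eq_of_mul_eq_one_right (StarAlgEquiv.ext fun x =>
    DFunLike.congr_fun (amplifyHom_comp he hE α α⁻¹ α.apply_symm_apply) x)

end Double

/-! ### Locality of automorphisms and of families of automorphisms. -/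

section Local

variable {P κ A I : Type*} [Fintype κ] [DecidableEq κ] [PseudoMetricSpace I]
  [Ring A] [StarRing A] [Algebra ℂ A]

/-- An automorphism that maps an operator on the qudit `p` to an operator on the ball of
radius `r` around `p`; here `s p` is the site of the qudit `p`. -/
def IsLocal (e : P → κ → κ → A) (s : P → I) (r : ℝ) (θ : A ≃⋆ₐ[ℂ] A) : Prop :=
  ∀ p a b, θ (e p a b) ∈ net e {p' | dist (s p') (s p) ≤ r}

/-- A family of local automorphisms, indexed by sets of sites, whose action on the qudit `p` depends
only on the part of the set in the ball of radius `r` around `p`. -/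
structure LocalFamily (e : P → κ → κ → A) (s : P → I) (r : ℝ) (w : Set I → A ≃⋆ₐ[ℂ] A) :
    Prop where
  isLocal : ∀ Y, IsLocal e s r (w Y)
  congr : ∀ Y Y' p, (∀ i, dist i (s p) ≤ r → (i ∈ Y ↔ i ∈ Y')) →
    ∀ a b, w Y (e p a b) = w Y' (e p a b)

variable {e : P → κ → κ → A} {s : P → I} {r r' : ℝ}

omit [Fintype κ] [DecidableEq κ] in
theorem IsLocal.map_mem {θ : A ≃⋆ₐ[ℂ] A} (h : IsLocal e s r θ) {K L : Set P} {x : A}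
    (hx : x ∈ net e K) (hKL : ∀ p ∈ K, ∀ p', dist (s p') (s p) ≤ r → p' ∈ L) :
    θ x ∈ net e L :=
  map_mem_of_forall_unit θ (fun p hp a b => net_mono (fun p' hp' => hKL p hp p' hp') (h p a b)) hx

omit [Fintype κ] [DecidableEq κ] in
theorem IsLocal.mono {θ : A ≃⋆ₐ[ℂ] A} (h : IsLocal e s r θ) (hr : r ≤ r') : IsLocal e s r' θ :=
  fun p a b => net_mono (fun _ hp' => le_trans hp' hr) (h p a b)

omit [Fintype κ] [DecidableEq κ] in
theorem IsLocal.mul {θ θ' : A ≃⋆ₐ[ℂ] A} (h : IsLocal e s r θ) (h' : IsLocal e s r' θ') :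
    IsLocal e s (r + r') (θ * θ') := fun p a b =>
  h.map_mem (h' p a b) fun p' hp' _ hp'' =>
    (dist_triangle _ (s p') _).trans (add_le_add hp'' hp')

/-- The radius does not grow: θ⁻¹(e_p) commutes with e_{p'} as soon as e_p commutes with θ(e_{p'}),
which holds when p is outside the ball around p'. The commutant criterion does the rest. -/
theorem IsLocal.inv [Nonempty κ] (he : IsQuditAlgebra e) {θ : A ≃⋆ₐ[ℂ] A}
    (h : IsLocal e s r θ) : IsLocal e s r θ⁻¹ := by
  intro p a b
  rw [he.mem_net_iff]
  intro p' hp' c d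
  have h1 : Commute (e p a b) (θ (e p' c d)) := by
    refine he.units.commute_of_disjoint (K := {p}) ?_ (unit_mem_net (Set.mem_singleton p) a b)
      (h p' c d)
    rw [Set.disjoint_singleton_left]
    intro h2
    exact hp' (by rw [Set.mem_ofPred_eq, dist_comm]; exact h2)
  have h2 := h1.map θ⁻¹
  have h3 : θ⁻¹ (θ (e p' c d)) = e p' c d := θ.symm_apply_apply _
  rwa [h3] at h2

omit [Fintype κ] [DecidableEq κ] in
theorem LocalFamily.const {θ : A ≃⋆ₐ[ℂ] A} (h : IsLocal e s r θ) :
    LocalFamily e s r (fun _ => θ) := ⟨fun _ => h, fun _ _ _ _ _ _ => rfl⟩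

omit [Fintype κ] [DecidableEq κ] in
theorem LocalFamily.congr_of_mem {w : Set I → A ≃⋆ₐ[ℂ] A} (h : LocalFamily e s r w)
    {Y Y' : Set I} {K : Set P} (hK : ∀ p ∈ K, ∀ i, dist i (s p) ≤ r → (i ∈ Y ↔ i ∈ Y')) {x : A}
    (hx : x ∈ net e K) : w Y x = w Y' x :=
  eq_of_mem_net _ _ (fun p hp a b => h.congr Y Y' p (hK p hp) a b) hx

omit [Fintype κ] [DecidableEq κ] in
theorem LocalFamily.mul {w w' : Set I → A ≃⋆ₐ[ℂ] A} (hr' : 0 ≤ r)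
    (h : LocalFamily e s r w) (h' : LocalFamily e s r' w') :
    LocalFamily e s (r + r') (fun Y => w Y * w' Y) := by
  refine ⟨fun Y => (h.isLocal Y).mul (h'.isLocal Y), fun Y Y' p hp a b => ?_⟩
  change w Y (w' Y (e p a b)) = w Y' (w' Y' (e p a b))
  rw [← h'.congr Y Y' p (fun i hi => hp i (by linarith)) a b]
  refine h.congr_of_mem ?_ (h'.isLocal Y p a b)
  intro p' hp' i hi
  exact hp i ((dist_triangle _ (s p') _).trans (add_le_add hi hp'))

end Local

/-! ### The commutator as a word in swaps, and its restriction to a set of sites. -/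

section Commutator

variable {P κ A B I : Type*} [Fintype κ] [DecidableEq κ]
  [Ring A] [StarRing A] [Algebra ℂ A] [Ring B] [StarRing B] [Algebra ℂ B]
  [StarModule ℂ A] [StarModule ℂ B] [Nontrivial A] [Nontrivial B]
  {e : P → κ → κ → A} {E : P ⊕ P → κ → κ → B} {s : P → I} {R : ℝ}

open Classical in
/-- Exchange of the two copies of the qudits on the sites in `Y`. -/
def swapPerm (s : P → I) (Y : Set I) : Equiv.Perm (P ⊕ P) :=
  Function.Involutive.toPerm (fun x => if Sum.elim s s x ∈ Y then x.swap else x) (by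
    rintro (p | p) <;> by_cases h : s p ∈ Y <;> simp [h])

theorem swapPerm_apply_of_mem {Y : Set I} {x : P ⊕ P} (h : Sum.elim s s x ∈ Y) :
    swapPerm s Y x = x.swap := if_pos h

theorem swapPerm_apply_of_notMem {Y : Set I} {x : P ⊕ P} (h : Sum.elim s s x ∉ Y) :
    swapPerm s Y x = x := if_neg h

theorem site_swapPerm (Y : Set I) (x : P ⊕ P) :
    Sum.elim s s (swapPerm s Y x) = Sum.elim s s x := by
  by_cases h : Sum.elim s s x ∈ Y
  · rw [swapPerm_apply_of_mem h]
    rcases x with p | p <;> rfl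
  · rw [swapPerm_apply_of_notMem h]

variable (he : IsQuditAlgebra e) (hE : IsQuditAlgebra E) (s)

/-- The automorphism that exchanges the two copies on the sites in `Y`. -/
def swapAut (Y : Set I) : B ≃⋆ₐ[ℂ] B := hE.perm (swapPerm s Y)

theorem swapAut_mul_self (Y : Set I) : swapAut s hE Y * swapAut s hE Y = 1 := by
  refine StarAlgEquiv.ext fun x => hE.hom_ext (swapAut s hE Y * swapAut s hE Y)
    (1 : B ≃⋆ₐ[ℂ] B) (fun p a b => ?_) x
  simp only [swapAut, StarAlgEquiv.mul_apply, hE.perm_unit, StarAlgEquiv.one_apply]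
  congr 1
  exact (swapPerm s Y).left_inv p

theorem swapAut_inv (Y : Set I) : (swapAut s hE Y)⁻¹ = swapAut s hE Y :=
  inv_eq_of_mul_eq_one_left (swapAut_mul_self s hE Y)

theorem swapAut_empty : swapAut s hE ∅ = 1 := by
  refine StarAlgEquiv.ext fun x => hE.hom_ext (swapAut s hE ∅)
    (1 : B ≃⋆ₐ[ℂ] B) (fun p a b => ?_) x
  simp only [swapAut, hE.perm_unit, StarAlgEquiv.one_apply]
  rw [swapPerm_apply_of_notMem (by simp)]

theorem swapAut_univ_inl (x : A) : swapAut s hE Set.univ (inl he hE x) = inr he hE x := by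
  refine he.hom_ext ((swapAut s hE Set.univ : B →⋆ₐ[ℂ] B).comp (inl he hE)) (inr he hE)
    (fun p a b => ?_) x
  change swapAut s hE Set.univ (inl he hE (e p a b)) = inr he hE (e p a b)
  rw [inl_unit, inr_unit, swapAut, hE.perm_unit, swapPerm_apply_of_mem (by simp), Sum.swap_inl]

theorem swapAut_univ_inr (x : A) : swapAut s hE Set.univ (inr he hE x) = inl he hE x := by
  rw [← swapAut_univ_inl s he hE, ← StarAlgEquiv.mul_apply, swapAut_mul_self,
    StarAlgEquiv.one_apply]

variable (α β : A ≃⋆ₐ[ℂ] A)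

/-- The commutator of `α ⊗ id` and `β ⊗ id`, written with swaps, with the swaps restricted to the
set `Y` of sites. -/
def commutatorOn (Y : Set I) : B ≃⋆ₐ[ℂ] B :=
  amplify he hE α * swapAut s hE Y * amplify he hE α⁻¹ * swapAut s hE Y * amplify he hE β *
    swapAut s hE Y * amplify he hE α * swapAut s hE Y * amplify he hE α⁻¹ * amplify he hE β⁻¹

/-- Written as a product so that the locality of the inverse, and its dependence on Y, can be read
off factor by factor. -/
theorem commutatorOn_inv (Y : Set I) : (commutatorOn s he hE α β Y)⁻¹ =
    amplify he hE β * amplify he hE α * swapAut s hE Y * amplify he hE α⁻¹ * swapAut s hE Y *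
      amplify he hE β⁻¹ * swapAut s hE Y * amplify he hE α * swapAut s hE Y *
        amplify he hE α⁻¹ := by
  simp only [commutatorOn, mul_inv_rev, amplify_inv, swapAut_inv, inv_inv, mul_assoc]

theorem commutatorOn_empty : commutatorOn s he hE α β ∅ = 1 := by
  simp only [commutatorOn, swapAut_empty, mul_one, ← amplify_inv]
  group

/-- Each pair of full swaps moves the automorphism between them to the second copy. There α⁻¹ and α
meet and cancel, while αβα⁻¹β⁻¹ is left on the first copy. -/
theorem commutatorOn_univ_inl (x : A) : commutatorOn s he hE α β Set.univ (inl he hE x) =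
    inl he hE ((α * β * α⁻¹ * β⁻¹) x) := by
  simp only [commutatorOn, StarAlgEquiv.mul_apply, amplify_inl, swapAut_univ_inl, amplify_inr,
    swapAut_univ_inr]

theorem commutatorOn_univ_inr (p : P) (a b : κ) :
    commutatorOn s he hE α β Set.univ (E (Sum.inr p) a b) = E (Sum.inr p) a b := by
  rw [← inr_unit he hE]
  simp only [commutatorOn, StarAlgEquiv.mul_apply, amplify_inl, swapAut_univ_inl, amplify_inr,
    swapAut_univ_inr]
  congr 1
  exact α.symm_apply_apply _

variable [PseudoMetricSpace I]

theorem swapAut_localFamily : LocalFamily E (Sum.elim s s) 0 (swapAut s hE) := by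
  refine ⟨fun Y x a b => ?_, fun Y Y' x h a b => ?_⟩
  · rw [swapAut, hE.perm_unit]
    refine unit_mem_net ?_ a b
    rw [Set.mem_ofPred_eq, site_swapPerm, dist_self]
  · rw [swapAut, swapAut, hE.perm_unit, hE.perm_unit]
    have h1 := h _ (dist_self _).le
    by_cases hx : Sum.elim s s x ∈ Y
    · rw [swapPerm_apply_of_mem hx, swapPerm_apply_of_mem (h1.1 hx)]
    · rw [swapPerm_apply_of_notMem hx, swapPerm_apply_of_notMem (fun h => hx (h1.2 h))]

theorem amplify_isLocal (hR : 0 ≤ R) {α : A ≃⋆ₐ[ℂ] A} (hα : IsLocal e s R α) :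
    IsLocal E (Sum.elim s s) R (amplify he hE α) := by
  rintro (p | p) a b
  · rw [← inl_unit he hE, amplify_inl]
    refine net_mono ?_ (inl_mem he hE (hα p a b))
    rintro _ ⟨p', hp', rfl⟩
    exact hp'
  · rw [amplify_inr_unit]
    exact unit_mem_net (by simpa using hR) a b

variable {α β} [Nonempty κ] (hR : 0 ≤ R) (hα : IsLocal e s R α) (hβ : IsLocal e s R β)

include hR hα hβ

/-- Six factors of the word have radius R and the swaps have radius 0, hence 6R. -/
theorem commutatorOn_localFamily :
    LocalFamily E (Sum.elim s s) (6 * R) (commutatorOn s he hE α β) := by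
  have a1 := LocalFamily.const (amplify_isLocal s he hE hR hα)
  have a2 := LocalFamily.const (amplify_isLocal s he hE hR (hα.inv he))
  have b1 := LocalFamily.const (amplify_isLocal s he hE hR hβ)
  have b2 := LocalFamily.const (amplify_isLocal s he hE hR (hβ.inv he))
  have S := swapAut_localFamily s hE
  have := ((((((((a1.mul hR S).mul (by simpa) a2).mul (by linarith) S).mul (by linarith) b1).mul
    (by linarith) S).mul (by linarith) a1).mul (by linarith) S).mul (by linarith) a2).mul
    (by linarith) b2
  convert this using 1
  · ring
  · rfl

theorem commutatorOn_inv_localFamily :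
    LocalFamily E (Sum.elim s s) (6 * R) (fun Y => (commutatorOn s he hE α β Y)⁻¹) := by
  have a1 := LocalFamily.const (amplify_isLocal s he hE hR hα)
  have a2 := LocalFamily.const (amplify_isLocal s he hE hR (hα.inv he))
  have b1 := LocalFamily.const (amplify_isLocal s he hE hR hβ)
  have b2 := LocalFamily.const (amplify_isLocal s he hE hR (hβ.inv he))
  have S := swapAut_localFamily s hE
  have := ((((((((b1.mul hR a1).mul (by linarith) S).mul (by linarith) a2).mul (by linarith) S).mul
    (by linarith) b2).mul (by linarith) S).mul (by linarith) a1).mul (by linarith) S).mul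
    (by linarith) a2
  convert this using 1
  · ring
  · funext Y
    exact commutatorOn_inv s he hE α β Y

/-- This and the next two lemmas compare Y, as seen from a single qudit, with the empty set or with
the set of all sites, where the word is known. -/
theorem commutatorOn_of_disjoint {Y : Set I} {x : P ⊕ P}
    (h : ∀ i, dist i (Sum.elim s s x) ≤ 6 * R → i ∉ Y) (a b : κ) :
    commutatorOn s he hE α β Y (E x a b) = E x a b := by
  rw [(commutatorOn_localFamily s he hE hR hα hβ).congr Y ∅ x
    (fun i hi => by simp [h i hi]) a b, commutatorOn_empty, StarAlgEquiv.one_apply]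

theorem commutatorOn_inr_of_subset {Y : Set I} {p : P}
    (h : ∀ i, dist i (s p) ≤ 6 * R → i ∈ Y) (a b : κ) :
    commutatorOn s he hE α β Y (E (Sum.inr p) a b) = E (Sum.inr p) a b := by
  rw [(commutatorOn_localFamily s he hE hR hα hβ).congr Y Set.univ (Sum.inr p)
    (fun i hi => by simp [h i hi]) a b, commutatorOn_univ_inr]

theorem commutatorOn_inv_inl_of_subset {Y : Set I} {p : P}
    (h : ∀ i, dist i (s p) ≤ 6 * R → i ∈ Y) (a b : κ) :
    (commutatorOn s he hE α β Y)⁻¹ (E (Sum.inl p) a b) =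
      inl he hE ((α * β * α⁻¹ * β⁻¹)⁻¹ (e p a b)) := by
  rw [(commutatorOn_inv_localFamily s he hE hR hα hβ).congr Y Set.univ (Sum.inl p)
    (fun i hi => by simp [h i hi]) a b]
  have h1 : ∀ γ : A ≃⋆ₐ[ℂ] A, ∀ x, γ (γ⁻¹ x) = x := fun γ x => γ.apply_symm_apply x
  have h2 : ∀ γ : B ≃⋆ₐ[ℂ] B, ∀ x, γ⁻¹ (γ x) = x := fun γ x => γ.symm_apply_apply x
  conv_lhs => rw [← inl_unit he hE, ← h1 (α * β * α⁻¹ * β⁻¹) (e p a b)]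
  rw [← commutatorOn_univ_inl s he hE α β, h2]

end Commutator

/-! ### Replacing the ancillas by qudits of the system. -/

section Exchange

variable {P : Type*}

/-- D and `j '' D` may overlap: the exchange pairs the second copy of D with the first copy of `j ''
D`, and these never meet. -/
theorem exists_exchange (D : Set P) (j : P → P) (hj : Set.InjOn j D) :
    ∃ τ : Equiv.Perm (P ⊕ P), (∀ p ∈ D, τ (Sum.inr p) = Sum.inl (j p)) ∧
      (∀ p ∉ D, τ (Sum.inr p) = Sum.inr p) ∧ (∀ p ∈ D, τ (Sum.inl (j p)) = Sum.inr p) ∧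
      (∀ p ∉ j '' D, τ (Sum.inl p) = Sum.inl p) := by
  classical
  let f : P ⊕ P → P ⊕ P := Sum.elim
    (fun p => if h : ∃ p' ∈ D, j p' = p then Sum.inr h.choose else Sum.inl p)
    (fun p => if p ∈ D then Sum.inl (j p) else Sum.inr p)
  have h1 : ∀ p ∈ D, f (Sum.inr p) = Sum.inl (j p) := fun p hp => if_pos hp
  have h2 : ∀ p ∉ D, f (Sum.inr p) = Sum.inr p := fun p hp => if_neg hp
  have h3 : ∀ p ∈ D, f (Sum.inl (j p)) = Sum.inr p := fun p hp => by
    have h : ∃ p' ∈ D, j p' = j p := ⟨p, hp, rfl⟩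
    have : f (Sum.inl (j p)) = Sum.inr h.choose := dif_pos h
    rw [this, hj h.choose_spec.1 hp h.choose_spec.2]
  have h4 : ∀ p ∉ j '' D, f (Sum.inl p) = Sum.inl p := fun p hp => dif_neg hp
  refine ⟨Function.Involutive.toPerm f ?_, h1, h2, h3, h4⟩
  rintro (p | p)
  · by_cases h : p ∈ j '' D
    · obtain ⟨p, hp, rfl⟩ := h
      rw [h3 p hp, h1 p hp]
    · rw [h4 p h, h4 p h]
  · by_cases h : p ∈ D
    · rw [h1 p h, h3 p h]
    · rw [h2 p h, h2 p h]

end Exchange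

section Transplant

variable {P κ A B I : Type*} [Fintype κ] [DecidableEq κ] [Nonempty κ] [PseudoMetricSpace I]
  [Ring A] [StarRing A] [Algebra ℂ A] [Ring B] [StarRing B] [Algebra ℂ B]
  [StarModule ℂ A] [StarModule ℂ B] [Nontrivial A] [Nontrivial B]
  {e : P → κ → κ → A} {E : P ⊕ P → κ → κ → B}

/-- A set `Y` of sites such that only the qudits in `D` are close to both `Y` and its complement,
and such that the qudits in `j '' D` are far from `Y`. -/
def Admissible (s : P → I) (r : ℝ) (D : Set P) (j : P → P) (Y : Set I) : Prop :=
  (∀ p ∉ D, (∀ i, dist i (s p) ≤ r → i ∈ Y) ∨ (∀ i, dist i (s p) ≤ r → i ∉ Y)) ∧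
    ∀ p ∈ D, ∀ i, dist i (s (j p)) ≤ r → i ∉ Y

/-- Interpolation between the identity and the commutator of two local automorphisms. The
automorphism `v Y` interpolates at the boundary of `Y`, where it uses the qudits in `j '' D`
in place of ancillas for the qudits in `D`. -/
theorem exists_interpolation (he : IsQuditAlgebra e) (hE : IsQuditAlgebra E) (s : P → I) {R t : ℝ}
    (hR : 0 ≤ R) {α β : A ≃⋆ₐ[ℂ] A} (hα : IsLocal e s R α) (hβ : IsLocal e s R β)
    (D : Set P) (j : P → P) (hj : Set.InjOn j D) (ht : 0 ≤ t)
    (hjt : ∀ p ∈ D, dist (s (j p)) (s p) ≤ t) :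
    ∃ v : Set I → A ≃⋆ₐ[ℂ] A,
      v ∅ = 1 ∧
      (∀ Y Y' Y'', Admissible s (6 * R) D j Y → Admissible s (6 * R) D j Y' →
        Admissible s (6 * R) D j Y'' → ∀ p,
        (∀ i, dist i (s p) ≤ 2 * (6 * R + 2 * t) → (i ∈ Y' ↔ i ∈ Y'')) → ∀ a b,
        (v Y' * (v Y)⁻¹) (e p a b) = (v Y'' * (v Y)⁻¹) (e p a b)) ∧
      (∀ Y, Admissible s (6 * R) D j Y → ∀ p, (∀ i, dist i (s p) ≤ 6 * R → i ∈ Y) → ∀ a b,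
        (v Y)⁻¹ (e p a b) = (α * β * α⁻¹ * β⁻¹)⁻¹ (e p a b)) ∧
      (∀ Y, Admissible s (6 * R) D j Y → ∀ z ρ,
        (∀ p ∈ D, dist (s p) z ≤ ρ + 6 * R → dist (s (j p)) z ≤ ρ) →
        (∀ p ∈ D, dist (s (j p)) z ≤ ρ → dist (s p) z ≤ ρ ∨
          (∀ i, dist i (s p) ≤ 6 * R → i ∈ Y) ∨ (∀ i, dist i (s p) ≤ 6 * R → i ∉ Y)) →
        ∀ p, dist (s p) z ≤ ρ → ∀ a b, (v Y)⁻¹ (e p a b) ∈ net e {p' | dist (s p') z ≤ ρ + 6 * R})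
      := by
  classical
  obtain ⟨τ, hτ1, hτ2, hτ3, hτ4⟩ := exists_exchange D j hj
  set r := 6 * R with hr
  have hr0 : 0 ≤ r := by positivity
  set w := commutatorOn s he hE α β with hw
  have hwL := commutatorOn_localFamily s he hE hR hα hβ
  have hwL' := commutatorOn_inv_localFamily s he hE hR hα hβ
  rw [← hr, ← hw] at hwL hwL'
  set T := hE.perm τ with hT
  have hinv : ∀ x, τ (τ x) = x := by
    rintro (p | p)
    · by_cases h : p ∈ j '' D
      · obtain ⟨p, hp, rfl⟩ := h
        rw [hτ3 p hp, hτ1 p hp]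
      · rw [hτ4 p h, hτ4 p h]
    · by_cases h : p ∈ D
      · rw [hτ1 p h, hτ3 p h]
      · rw [hτ2 p h, hτ2 p h]
  have hTinv : T⁻¹ = T := by
    refine inv_eq_of_mul_eq_one_left (StarAlgEquiv.ext fun x =>
      hE.hom_ext (T * T) (1 : B ≃⋆ₐ[ℂ] B) (fun p a b => ?_) x)
    simp only [StarAlgEquiv.mul_apply, hT, hE.perm_unit, hinv, StarAlgEquiv.one_apply]
  have hTT : ∀ x, T (T x) = x := fun x => by
    conv_lhs => enter [2]; rw [← hTinv]
    exact T.apply_symm_apply x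
  have hTu : ∀ x a b, T (E x a b) = E (τ x) a b := fun x a b => hE.perm_unit τ x a b
  have hTL : IsLocal E (Sum.elim s s) t T := by
    intro x a b
    rw [hTu]
    refine unit_mem_net ?_ a b
    rw [Set.mem_ofPred_eq]
    rcases x with p | p
    · by_cases h : p ∈ j '' D
      · obtain ⟨p, hp, rfl⟩ := h
        rw [hτ3 p hp, dist_comm]
        exact hjt p hp
      · rw [hτ4 p h, dist_self]; exact ht
    · by_cases h : p ∈ D
      · rw [hτ1 p h]; exact hjt p h
      · rw [hτ2 p h, dist_self]; exact ht
  let W : Set I → B ≃⋆ₐ[ℂ] B := fun Y => T * w Y * T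
  have hWinv : ∀ Y, (W Y)⁻¹ = T * (w Y)⁻¹ * T := fun Y => by
    simp only [W, mul_inv_rev, hTinv, mul_assoc]
  have hWL : LocalFamily E (Sum.elim s s) (r + 2 * t) W := by
    have := ((LocalFamily.const hTL).mul ht hwL).mul (by positivity) (LocalFamily.const hTL)
    convert this using 1
    ring
  have hWL' : LocalFamily E (Sum.elim s s) (r + 2 * t) (fun Y => (W Y)⁻¹) := by
    have := ((LocalFamily.const hTL).mul ht hwL').mul (by positivity) (LocalFamily.const hTL)
    simp only [hWinv]
    convert this using 1
    ring
  have hWfix : ∀ Y, Admissible s r D j Y → ∀ p a b,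
      W Y (E (Sum.inr p) a b) = E (Sum.inr p) a b := by
    intro Y hY p a b
    change T (w Y (T (E (Sum.inr p) a b))) = _
    have : w Y (T (E (Sum.inr p) a b)) = T (E (Sum.inr p) a b) := by
      rw [hTu]
      by_cases h : p ∈ D
      · rw [hτ1 p h]
        exact commutatorOn_of_disjoint s he hE hR hα hβ (x := Sum.inl (j p))
          (fun i hi => hY.2 p h i hi) a b
      · rw [hτ2 p h]
        rcases hY.1 p h with h' | h'
        · exact commutatorOn_inr_of_subset s he hE hR hα hβ h' a b
        · exact commutatorOn_of_disjoint s he hE hR hα hβ (x := Sum.inr p) h' a b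
    rw [this, hTT]
  have hv : ∀ Y, ∃ v : A ≃⋆ₐ[ℂ] A, Admissible s r D j Y →
      ∀ x, inl he hE (v x) = W Y (inl he hE x) := by
    intro Y
    by_cases hY : Admissible s r D j Y
    · obtain ⟨v, hv⟩ := exists_restrict he hE (W Y) (hWfix Y hY)
      exact ⟨v, fun _ => hv⟩
    · exact ⟨1, fun h => absurd h hY⟩
  choose v hv using hv
  have hinj := he.injective (inl he hE)
  have hvinv : ∀ Y, Admissible s r D j Y → ∀ x, inl he hE ((v Y)⁻¹ x) = (W Y)⁻¹ (inl he hE x) := by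
    intro Y hY x
    have h1 := hv Y hY ((v Y)⁻¹ x)
    rw [show v Y ((v Y)⁻¹ x) = x from (v Y).apply_symm_apply x] at h1
    rw [h1]
    exact ((W Y).symm_apply_apply _).symm
  refine ⟨v, ?_, ?_, ?_, ?_⟩
  · refine StarAlgEquiv.ext fun x => hinj ?_
    rw [hv ∅ ⟨fun p _ => Or.inr (by simp), by simp⟩, StarAlgEquiv.one_apply]
    simp only [W, hw, commutatorOn_empty, mul_one, StarAlgEquiv.mul_apply, hTT]
  · intro Y Y' Y'' hY hY' hY'' p hp a b
    refine hinj ?_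
    simp only [StarAlgEquiv.mul_apply]
    rw [hv Y' hY', hv Y'' hY'', hvinv Y hY, inl_unit]
    refine hWL.congr_of_mem ?_ (hWL'.isLocal Y (Sum.inl p) a b)
    intro x hx i hi
    refine hp i ((dist_triangle _ (Sum.elim s s x) _).trans ?_)
    rw [two_mul]
    exact add_le_add hi hx
  · intro Y hY p hp a b
    have hpj : ∀ p', dist (s p') (s p) ≤ r → p' ∉ j '' D := by
      rintro _ hp' ⟨p', hp'D, rfl⟩
      exact hY.2 p' hp'D (s p) (by rwa [dist_comm]) (hp _ (by simpa using hr0))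
    refine hinj ?_
    rw [hvinv Y hY, hWinv]
    change T ((w Y)⁻¹ (T (inl he hE (e p a b)))) = _
    rw [inl_unit, hTu, hτ4 p (hpj p (by simpa using hr0))]
    have h1 := commutatorOn_inv_inl_of_subset s he hE hR hα hβ (Y := Y) (p := p) hp a b
    have h2 := hwL'.isLocal Y (Sum.inl p) a b
    rw [← hw] at h1
    rw [← h1]
    change (w Y)⁻¹ (E (Sum.inl p) a b) ∈ _ at h2
    have h3 : (w Y)⁻¹ (E (Sum.inl p) a b) ∈ net E (Sum.inl '' {p' | dist (s p') (s p) ≤ r}) := by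
      rw [h1] at h2 ⊢
      rw [inl_mem_iff] at h2
      exact inl_mem he hE h2
    refine eq_of_mem_net T (1 : B ≃⋆ₐ[ℂ] B) ?_ h3
    rintro _ ⟨p', hp', rfl⟩ c d
    rw [hTu, hτ4 p' (hpj p' hp'), StarAlgEquiv.one_apply]
  · intro Y hY z ρ hρ1 hρ2 p hp a b
    have key : ∀ x : P ⊕ P, dist (Sum.elim s s x) z ≤ ρ → ∀ c d,
        T ((w Y)⁻¹ (E x c d)) ∈ net E {y | ∀ p', y = Sum.inl p' → dist (s p') z ≤ ρ + r} := by
      intro x hx c d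
      refine map_mem_of_forall_unit T ?_ (hwL'.isLocal Y x c d)
      intro y hy c' d'
      rw [hTu]
      refine unit_mem_net ?_ c' d'
      have hy' : dist (Sum.elim s s y) z ≤ ρ + r := by
        have := dist_triangle (Sum.elim s s y) (Sum.elim s s x) z
        have hy'' : dist (Sum.elim s s y) (Sum.elim s s x) ≤ r := hy
        linarith
      rintro p' hyp'
      rcases y with q | q
      · by_cases h : q ∈ j '' D
        · obtain ⟨q, hq, rfl⟩ := h
          rw [hτ3 q hq] at hyp'
          cases hyp'
        · rw [hτ4 q h] at hyp'
          cases hyp'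
          exact hy'
      · by_cases h : q ∈ D
        · rw [hτ1 q h] at hyp'
          cases hyp'
          exact (hρ1 q h hy').trans (by linarith)
        · rw [hτ2 q h] at hyp'
          cases hyp'
    suffices h : T ((w Y)⁻¹ (T (E (Sum.inl p) a b))) ∈
        net E {y | ∀ p', y = Sum.inl p' → dist (s p') z ≤ ρ + r} by
      have h1 : inl he hE ((v Y)⁻¹ (e p a b)) ∈
          net E {y | ∀ p', y = Sum.inl p' → dist (s p') z ≤ ρ + r} := by
        rw [hvinv Y hY, hWinv, inl_unit]
        exact h
      rw [inl_mem_iff] at h1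
      refine net_mono ?_ h1
      intro p' hp'
      exact hp' p' rfl
    rw [hTu]
    by_cases h : p ∈ j '' D
    · obtain ⟨q, hq, rfl⟩ := h
      rw [hτ3 q hq]
      have hfix : w Y (E (Sum.inr q) a b) = E (Sum.inr q) a b →
          T ((w Y)⁻¹ (E (Sum.inr q) a b)) ∈
            net E {y | ∀ p', y = Sum.inl p' → dist (s p') z ≤ ρ + r} := by
        intro h
        have h' : (w Y)⁻¹ (E (Sum.inr q) a b) = E (Sum.inr q) a b := by
          conv_lhs => rw [← h]
          exact (w Y).symm_apply_apply _
        rw [h', hTu, hτ1 q hq]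
        refine unit_mem_net ?_ a b
        rintro p' hp'
        cases hp'
        linarith
      rcases hρ2 q hq hp with h' | h' | h'
      · exact key (Sum.inr q) h' a b
      · exact hfix (commutatorOn_inr_of_subset s he hE hR hα hβ h' a b)
      · exact hfix (commutatorOn_of_disjoint s he hE hR hα hβ (x := Sum.inr q) h' a b)
    · rw [hτ4 p h]
      exact key (Sum.inl p) hp a b

end Transplant

section SkolemNoether

variable {P : Type*} {κ : Type u} {A : Type*} [Fintype κ] [DecidableEq κ] [Nonempty κ]
  [Ring A] [StarRing A] [Algebra ℂ A] {e : P → κ → κ → A}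

/-- Finitely many qudits can be merged into a single one. -/
theorem IsMatrixUnits.exists_merge (he : IsMatrixUnits e) (F : Finset P) :
    ∃ (ι : Type u) (_ : Fintype ι) (_ : DecidableEq ι) (_ : Nonempty ι) (E : ι → ι → A),
      IsMatrixUnits (fun _ : Unit => E) ∧ (∀ s t, E s t ∈ net e (F : Set P)) ∧
        ∀ x ∈ net e (F : Set P), ∃ c : ι → ι → ℂ, x = ∑ s, ∑ t, c s t • E s t := by
  classical
  induction F using Finset.induction_on with
  | empty =>
    refine ⟨PUnit, inferInstance, inferInstance, inferInstance, fun _ _ => 1,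
      ⟨by simp, by simp, fun _ _ h => absurd rfl h, by simp⟩, fun _ _ => one_mem _, ?_⟩
    intro x hx
    have : net e ((∅ : Finset P) : Set P) = ⊥ := by simp [net]
    rw [this, Algebra.mem_bot] at hx
    obtain ⟨r, rfl⟩ := hx
    exact ⟨fun _ _ => r, by simp [Algebra.algebraMap_eq_smul_one]⟩
  | insert p F hp ih =>
    obtain ⟨ι, _, _, _, E, hE, hEF, hspan⟩ := ih
    have hcomm : ∀ s t a b, Commute (e p a b) (E s t) := fun s t a b =>
      he.commute_of_disjoint (K := {p}) (by simpa using hp) (unit_mem_net (Set.mem_singleton p) a b)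
        (hEF s t)
    have hFi : net e (F : Set P) ≤ net e (↑(insert p F) : Set P) := net_mono (by simp)
    refine ⟨ι × κ, inferInstance, inferInstance, inferInstance,
      fun s t => E s.1 t.1 * e p s.2 t.2, ⟨?_, ?_, fun _ _ h => absurd rfl h, ?_⟩, ?_, ?_⟩
    · rintro - ⟨s, a⟩ ⟨t, b⟩ ⟨s', a'⟩ ⟨t', b'⟩
      dsimp only
      rw [mul_assoc, ← mul_assoc (e p a b), (hcomm s' t' a b).eq, mul_assoc, ← mul_assoc,
        he.mul_self, hE.mul_self ()]
      by_cases h1 : t = s' <;> by_cases h2 : b = a' <;> simp [h1, h2]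
    · intro _
      rw [Fintype.sum_prod_type]
      simp only [← Finset.mul_sum, he.sum_diag, mul_one]
      exact hE.sum_diag ()
    · rintro - ⟨s, a⟩ ⟨t, b⟩
      rw [star_mul, he.star_eq, hE.star_eq (), (hcomm _ _ _ _).eq]
    · rintro ⟨s, a⟩ ⟨t, b⟩
      exact mul_mem (hFi (hEF s t)) (unit_mem_net (by simp) a b)
    · intro x hx
      obtain ⟨y, hy, rfl⟩ := he.exists_expansion p hx
      have hy' : ∀ a b, ∃ c : ι → ι → ℂ, y a b = ∑ s, ∑ t, c s t • E s t := fun a b =>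
        hspan _ (net_mono (by simp) (hy a b))
      choose c hc using hy'
      refine ⟨fun s t => c s.2 t.2 s.1 t.1, ?_⟩
      simp only [Fintype.sum_prod_type, hc, Finset.mul_sum, mul_smul_comm, (hcomm _ _ _ _).eq]
      symm
      rw [Finset.sum_comm]
      refine Finset.sum_congr rfl fun a _ => ?_
      exact (Finset.sum_congr rfl fun s _ => Finset.sum_comm).trans Finset.sum_comm

theorem IsMatrixUnits.finite_net (he : IsMatrixUnits e) (F : Finset P) :
    Module.Finite ℂ (net e (F : Set P)) := by
  obtain ⟨ι, _, _, _, E, -, hEF, hspan⟩ := he.exists_merge F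
  refine Module.Finite.of_surjective (Fintype.linearCombination ℂ
    (fun s : ι × ι => (⟨E s.1 s.2, hEF _ _⟩ : net e (F : Set P)))) ?_
  rintro ⟨x, hx⟩
  obtain ⟨c, rfl⟩ := hspan x hx
  refine ⟨fun s => c s.1 s.2, Subtype.ext ?_⟩
  simp [Fintype.linearCombination_apply, Fintype.sum_prod_type]

theorem IsMatrixUnits.mul_star_eq_one (he : IsMatrixUnits e) (F : Finset P) {x y : A}
    (hx : x ∈ net e (F : Set P)) (hy : y ∈ net e (F : Set P)) (h : x * y = 1) : y * x = 1 := by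
  have := he.finite_net F
  let x' : net e (F : Set P) := ⟨x, hx⟩
  let y' : net e (F : Set P) := ⟨y, hy⟩
  have hxy : x' * y' = 1 := Subtype.ext h
  have hinj : Function.Injective (LinearMap.mulLeft ℂ y') := by
    intro a b hab
    have h1 : x' * (y' * a) = x' * (y' * b) := congrArg (x' * ·) hab
    rwa [← mul_assoc, ← mul_assoc, hxy, one_mul, one_mul] at h1
  obtain ⟨z, hz⟩ := LinearMap.injective_iff_surjective.1 hinj 1
  have hz' : y' * z = 1 := hz
  have : x' = z := by rw [← mul_one x', ← hz', ← mul_assoc, hxy, one_mul]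
  rw [← this] at hz'
  exact congrArg Subtype.val hz'

theorem IsQuditAlgebra.exists_algebraMap_eq (he : IsQuditAlgebra e) {F : Set P} {x : A}
    (hx : x ∈ net e F) (hc : ∀ y ∈ net e F, Commute x y) : ∃ z : ℂ, algebraMap ℂ A z = x := by
  have h : x ∈ net e (∅ : Set P) := by
    rw [he.mem_net_iff]
    intro p _ a b
    by_cases hp : p ∈ F
    · exact hc _ (unit_mem_net hp a b)
    · exact he.mem_net_iff.1 hx p hp a b
  have h0 : net e (∅ : Set P) = ⊥ := by simp [net]
  rw [h0, Algebra.mem_bot] at h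
  exact h

omit [Fintype κ] [DecidableEq κ] [Nonempty κ] in
theorem star_mem_net (hs : ∀ p a b, star (e p a b) = e p b a) [StarModule ℂ A] {K : Set P} {x : A}
    (hx : x ∈ net e K) : star x ∈ net e K := by
  induction hx using Algebra.adjoin_induction with
  | mem x hx =>
    obtain ⟨p, hp, a, b, rfl⟩ := hx
    rw [hs]
    exact unit_mem_net hp b a
  | algebraMap r => rw [← algebraMap_star_comm]; exact Subalgebra.algebraMap_mem _ _
  | add x y _ _ ihx ihy => rw [star_add]; exact add_mem ihx ihy
  | mul x y _ _ ihx ihy => rw [star_mul]; exact mul_mem ihy ihx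

/-- An automorphism of the algebra of finitely many qudits is conjugation by a unitary. -/
theorem IsQuditAlgebra.exists_unitary [StarModule ℂ A] [Nontrivial A] (he : IsQuditAlgebra e)
    (hpos : ∀ g : A, g ≠ 0 → ∀ z : ℂ, star g * g = algebraMap ℂ A z → ∃ r : ℝ, 0 < r ∧ z = r)
    (F : Finset P) (θ : A ≃⋆ₐ[ℂ] A) (hθ : ∀ x ∈ net e (F : Set P), θ x ∈ net e (F : Set P)) :
    ∃ g ∈ unitary A, g ∈ net e (F : Set P) ∧ ∀ x ∈ net e (F : Set P), θ x = g * x * star g := by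
  obtain ⟨ι, _, _, ⟨o⟩, E, hE, hEF, hspan⟩ := he.units.exists_merge F
  have hEm : ∀ a b c d, E a b * E c d = if b = c then E a d else 0 := hE.mul_self ()
  have hθE : ∀ a b c d, θ (E a b) * θ (E c d) = if b = c then θ (E a d) else 0 := by
    intro a b c d
    rw [← map_mul, hEm]
    split_ifs <;> simp
  have hsum : ∑ a, E a a = 1 := hE.sum_diag ()
  have hstar : ∀ a b, star (E a b) = E b a := hE.star_eq ()
  have hne : θ (E o o) ≠ 0 := by
    intro h
    have h0 : E o o = 0 := (map_eq_zero_iff θ θ.injective).1 h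
    have : (1 : A) = 0 := by
      rw [← hsum]
      refine Finset.sum_eq_zero fun a _ => ?_
      have h1 : E a o * E o o * E o a = E a a := by simp [hEm]
      rw [← h1, h0]; simp
    exact one_ne_zero this
  obtain ⟨t, ht⟩ : ∃ t, θ (E o o) * E t o ≠ 0 := by
    by_contra! h
    refine hne ?_
    rw [← mul_one (θ (E o o)), ← hsum, Finset.mul_sum]
    refine Finset.sum_eq_zero fun a _ => ?_
    have : E a a = E a o * E o a := by simp [hEm]
    rw [this, ← mul_assoc, h, zero_mul]
  set g := ∑ s, θ (E s o) * E t o * E o s with hg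
  have hgE : ∀ a b, θ (E a b) * g = θ (E a o) * E t o * E o b := by
    intro a b
    rw [hg, Finset.mul_sum, Finset.sum_eq_single b]
    · rw [← mul_assoc, ← mul_assoc, hθE, if_pos rfl]
    · intro c _ hc
      rw [← mul_assoc, ← mul_assoc, hθE, if_neg (Ne.symm hc), zero_mul, zero_mul]
    · simp
  have hgE' : ∀ a b, g * E a b = θ (E a o) * E t o * E o b := by
    intro a b
    rw [hg, Finset.sum_mul, Finset.sum_eq_single a]
    · rw [mul_assoc, hEm, if_pos rfl]
    · intro c _ hc
      rw [mul_assoc, hEm, if_neg hc, mul_zero]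
    · simp
  have hgx : ∀ x ∈ net e (F : Set P), θ x * g = g * x := by
    intro x hx
    obtain ⟨c, rfl⟩ := hspan x hx
    simp only [map_sum, map_smul, Finset.sum_mul, Finset.mul_sum, smul_mul_assoc, mul_smul_comm,
      hgE, hgE']
  have hgF : g ∈ net e (F : Set P) :=
    sum_mem fun s _ => mul_mem (mul_mem (hθ _ (hEF _ _)) (hEF _ _)) (hEF _ _)
  have hg0 : g ≠ 0 := by
    intro h
    apply ht
    have h1 := hgE o o
    rw [h, mul_zero, mul_assoc, hEm, if_pos rfl] at h1
    exact h1.symm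
  have hsF : ∀ {x}, x ∈ net e (F : Set P) → star x ∈ net e (F : Set P) := fun hx =>
    star_mem_net he.units.star_eq hx
  have hcen : ∀ y ∈ net e (F : Set P), Commute (star g * g) y := by
    intro y hy
    have h1 : star g * θ y = y * star g := by
      have := congrArg star (hgx (star y) (hsF hy))
      rwa [star_mul, star_mul, ← map_star, star_star] at this
    change star g * g * y = y * (star g * g)
    rw [mul_assoc, ← hgx y hy, ← mul_assoc, h1, mul_assoc]
  obtain ⟨z, hz⟩ := he.exists_algebraMap_eq (mul_mem (hsF hgF) hgF) hcen
  obtain ⟨r, hr, rfl⟩ := hpos g hg0 z hz.symm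
  set c : ℂ := (((Real.sqrt r)⁻¹ : ℝ) : ℂ) with hc
  have hcc : c * c * (r : ℂ) = 1 := by
    rw [hc]
    norm_cast
    rw [← mul_inv, Real.mul_self_sqrt hr.le, inv_mul_cancel₀ hr.ne']
  have hstarc : star c = c := by rw [hc]; exact Complex.conj_ofReal _
  have huF : c • g ∈ net e (F : Set P) := Subalgebra.smul_mem _ hgF c
  have hu1 : star (c • g) * (c • g) = 1 := by
    rw [star_smul, hstarc, smul_mul_smul_comm, ← hz, Algebra.algebraMap_eq_smul_one, smul_smul,
      hcc, one_smul]
  have hu2 := he.units.mul_star_eq_one F (hsF huF) huF hu1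
  refine ⟨c • g, Unitary.mem_iff.2 ⟨hu1, hu2⟩, huF, fun x hx => ?_⟩
  have h1 : θ x * (c • g) = c • g * x := by
    rw [mul_smul_comm, smul_mul_assoc, hgx x hx]
  rw [← h1, mul_assoc, hu2, mul_one]

/-- An automorphism that acts separately on disjoint finite systems is conjugation by a product of
unitaries on these systems. -/
theorem IsQuditAlgebra.exists_gates [StarModule ℂ A] [Nontrivial A] (he : IsQuditAlgebra e)
    (hpos : ∀ g : A, g ≠ 0 → ∀ z : ℂ, star g * g = algebraMap ℂ A z → ∃ r : ℝ, 0 < r ∧ z = r)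
    {I : Type*} {s : P → I} (sets : Set (Set I)) (hdisj : sets.PairwiseDisjoint id)
    (hfin : ∀ S ∈ sets, (s ⁻¹' S).Finite) (θ : A ≃⋆ₐ[ℂ] A)
    (hθ : ∀ S ∈ sets, ∀ p, s p ∈ S → ∀ a b, θ (e p a b) ∈ net e (s ⁻¹' S))
    (hfix : ∀ p, (∀ S ∈ sets, s p ∉ S) → ∀ a b, θ (e p a b) = e p a b) :
    ∃ g : Set I → A, (∀ S ∈ sets, g S ∈ unitary A ∧ g S ∈ net e (s ⁻¹' S)) ∧
      ∀ (J : Set I) (l : List (Set I)), l.Nodup → (∀ S ∈ l, S ∈ sets) →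
        (∀ S ∈ sets, (S ∩ J).Nonempty → S ∈ l) → ∀ x ∈ net e (s ⁻¹' J),
          θ x = (l.map g).prod * x * star (l.map g).prod := by
  classical
  have hgate : ∀ S : Set I, ∃ g : A, S ∈ sets → g ∈ unitary A ∧ g ∈ net e (s ⁻¹' S) ∧
      ∀ x ∈ net e (s ⁻¹' S), θ x = g * x * star g := by
    intro S
    by_cases hS : S ∈ sets
    · have hF := (hfin S hS).coe_toFinset
      obtain ⟨g, hg⟩ := he.exists_unitary hpos (hfin S hS).toFinset θ (by
        rw [hF]
        exact fun x hx => map_mem_of_forall_unit θ (hθ S hS) hx)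
      rw [hF] at hg
      exact ⟨g, fun _ => hg⟩
    · exact ⟨1, fun h => absurd h hS⟩
  choose g hg using hgate
  refine ⟨g, fun S hS => ⟨(hg S hS).1, (hg S hS).2.1⟩, ?_⟩
  intro J l hnd hl hcov
  have hprod : ∀ l : List (Set I), (∀ S ∈ l, S ∈ sets) → (l.map g).prod ∈ unitary A := by
    intro l hl
    refine list_prod_mem fun U hU => ?_
    obtain ⟨S, hS, rfl⟩ := List.mem_map.1 hU
    exact (hg S (hl S hS)).1
  set Q := (l.map g).prod with hQ
  have hQu : Q ∈ unitary (A) := hprod l hl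
  have hfar : ∀ (l : List (Set I)), (∀ S ∈ l, S ∈ sets) → ∀ (S : Set I),
      (∀ S' ∈ l, Disjoint S' S) → ∀ x ∈ net (e) (s ⁻¹' S),
        Commute (l.map g).prod x := by
    intro l hl S hS x hx
    refine Commute.list_prod_left _ _ ?_
    intro y hy
    obtain ⟨S', hS', rfl⟩ := List.mem_map.1 hy
    exact he.units.commute_of_disjoint
      ((hS S' hS').preimage _) (hg S' (hl S' hS')).2.1 hx
  have hin : ∀ (l : List (Set I)), l.Nodup → (∀ S ∈ l, S ∈ sets) → ∀ S ∈ l,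
      ∀ x ∈ net (e) (s ⁻¹' S),
        θ x = (l.map g).prod * x * star (l.map g).prod := by
    intro l
    induction l with
    | nil => intro _ _ S hS; simp at hS
    | cons S₀ l ih =>
      intro hnd hl S hS x hx
      have hl' : ∀ S ∈ l, S ∈ sets := fun S hS => hl S (List.mem_cons_of_mem _ hS)
      have hS₀ := hl S₀ (by simp)
      rw [List.map_cons, List.prod_cons, star_mul]
      by_cases h : S = S₀
      · subst h
        have hd : ∀ S' ∈ l, Disjoint S' S := fun S' hS' =>
          hdisj (hl' S' hS') hS₀ (fun h => (List.nodup_cons.1 hnd).1 (h ▸ hS'))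
        have hu : (l.map g).prod * star (l.map g).prod = 1 :=
          Unitary.mul_star_self_of_mem (hprod l hl')
        have hc := (hfar l hl' S hd x hx).eq
        calc θ x = g S * x * star (g S) := (hg S hS₀).2.2 x hx
          _ = g S * (x * ((l.map g).prod * star (l.map g).prod)) * star (g S) := by
            rw [hu, mul_one]
          _ = g S * ((x * (l.map g).prod) * star (l.map g).prod) * star (g S) := by
            simp only [mul_assoc]
          _ = _ := by rw [← hc]; simp only [mul_assoc]
      · have hSl : S ∈ l := (List.mem_cons.1 hS).resolve_left h
        have hd : Disjoint S₀ S := hdisj hS₀ (hl' S hSl) (Ne.symm h)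
        have h1 := ih (List.nodup_cons.1 hnd).2 hl' S hSl x hx
        have hθx : θ x ∈ net (e) (s ⁻¹' S) :=
          map_mem_of_forall_unit (e := e) θ
            (K := s ⁻¹' S) (S := net (e) (s ⁻¹' S))
            (hθ S (hl' S hSl)) hx
        have hc : g S₀ * θ x = θ x * g S₀ :=
          (he.units.commute_of_disjoint
            (hd.preimage _) (hg S₀ hS₀).2.1 hθx).eq
        have hu : g S₀ * star (g S₀) = 1 := Unitary.mul_star_self_of_mem (hg S₀ hS₀).1
        calc θ x = θ x * (g S₀ * star (g S₀)) := by rw [hu, mul_one]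
          _ = g S₀ * θ x * star (g S₀) := by rw [← mul_assoc, ← hc]
          _ = _ := by rw [h1]; simp only [mul_assoc]
  have hconj : ∀ x ∈ net (e) (s ⁻¹' J : Set (P)),
      θ x * Q = Q * x := by
    have hgen : ∀ p : P, s p ∈ J → ∀ a b,
        θ (e p a b) * Q = Q * e p a b := by
      intro p hp a b
      have hQ1 : star Q * Q = 1 := Unitary.star_mul_self_of_mem hQu
      by_cases h : ∃ S ∈ sets, s p ∈ S
      · obtain ⟨S, hS, hpS⟩ := h
        have := hin l hnd hl S (hcov S hS ⟨s p, hpS, hp⟩) _ (unit_mem_net (show p ∈ s ⁻¹' S from hpS) a b)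
        rw [this]
        change Q * _ * star Q * Q = _
        rw [mul_assoc, hQ1, mul_one]
      · push Not at h
        rw [hfix p h]
        refine (hfar l hl {s p} ?_ _ (unit_mem_net (show p ∈ s ⁻¹' {s p} from Set.mem_singleton _) a b)).eq.symm
        intro S hS
        rw [Set.disjoint_singleton_right]
        exact h S (hl S hS)
    intro x hx
    induction hx using Algebra.adjoin_induction with
    | mem x hx =>
      obtain ⟨p, hp, a, b, rfl⟩ := hx
      exact hgen p hp a b
    | algebraMap z =>
      have : θ (algebraMap ℂ A z) = algebraMap ℂ A z := AlgHomClass.commutes θ z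
      rw [this]
      exact Algebra.commutes z Q
    | add x y _ _ ihx ihy => rw [map_add, add_mul, mul_add, ihx, ihy]
    | mul x y _ _ ihx ihy => rw [map_mul, mul_assoc, ihy, ← mul_assoc, ihx, mul_assoc]
  intro O hO
  rw [← hconj O hO, mul_assoc, Unitary.mul_star_self_of_mem hQu, mul_one]

end SkolemNoether

section MatrixModel

variable {K κ : Type*} [Fintype K] [DecidableEq K] [Fintype κ] [DecidableEq κ]

/-- The matrix units of the tensor factor `k` of the matrix algebra over `K → κ`. -/
def tensorUnit (k : K) (a b : κ) : Matrix (K → κ) (K → κ) ℂ :=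
  Matrix.of fun s t => if s k = a ∧ t = Function.update s k b then 1 else 0

theorem tensorUnit_mul_apply (k : K) (a b : κ) (M : Matrix (K → κ) (K → κ) ℂ) (s t : K → κ) :
    (tensorUnit k a b * M) s t = if s k = a then M (Function.update s k b) t else 0 := by
  rw [Matrix.mul_apply, Finset.sum_eq_single (Function.update s k b)]
  · by_cases h : s k = a <;> simp [tensorUnit, h]
  · intro u _ hu
    simp [tensorUnit, hu]
  · simp

theorem tensorUnit_isMatrixUnits :
    IsMatrixUnits (tensorUnit : K → κ → κ → Matrix (K → κ) (K → κ) ℂ) where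
  mul_self k a b c d := by
    ext s t
    rw [tensorUnit_mul_apply]
    by_cases h : b = c <;> by_cases h' : s k = a <;> simp [tensorUnit, h, h']
  sum_diag k := by
    ext s t
    rw [Matrix.sum_apply, Finset.sum_eq_single (s k)]
    · simp [tensorUnit, Matrix.one_apply, eq_comm]
    · intro a _ ha
      simp [tensorUnit, ha.symm]
    · simp
  commute k k' h a b c d := by
    ext s t
    rw [tensorUnit_mul_apply, tensorUnit_mul_apply]
    by_cases h1 : s k = a <;> by_cases h2 : s k' = c <;>
      simp [tensorUnit, h1, h2, Function.update_of_ne h, Function.update_of_ne h.symm,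
        Function.update_comm h]
  star_eq k a b := by
    ext s t
    have : (t k = a ∧ s = Function.update t k b) ↔ (s k = b ∧ t = Function.update s k a) := by
      constructor
      · rintro ⟨rfl, rfl⟩; simp
      · rintro ⟨rfl, rfl⟩; simp
    simp only [tensorUnit, Matrix.star_apply, Matrix.of_apply, this]
    split_ifs <;> simp

theorem net_tensorUnit :
    net (tensorUnit : K → κ → κ → Matrix (K → κ) (K → κ) ℂ) Set.univ = ⊤ := by
  have key : ∀ (G : Finset K) (s t : K → κ), (Matrix.of fun u v =>
      if (∀ k ∈ G, u k = s k) ∧ v = G.piecewise t u then (1 : ℂ) else 0) ∈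
        net (tensorUnit : K → κ → κ → Matrix (K → κ) (K → κ) ℂ) Set.univ := by
    intro G s t
    induction G using Finset.induction_on with
    | empty =>
      have : (Matrix.of fun u v => if (∀ k ∈ (∅ : Finset K), u k = s k) ∧
          v = (∅ : Finset K).piecewise t u then (1 : ℂ) else 0) = 1 := by
        ext u v
        simp [Matrix.one_apply, eq_comm]
      rw [this]
      exact one_mem _
    | insert k G hk ih =>
      convert mul_mem (unit_mem_net (Set.mem_univ k) (s k) (t k)) ih using 1
      ext u v
      rw [tensorUnit_mul_apply]
      have h1 : ∀ k' ∈ G, Function.update u k (t k) k' = u k' := fun k' hk' =>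
        Function.update_of_ne (fun h => hk (by rwa [← h])) _ _
      have h2 : (insert k G).piecewise t u = G.piecewise t (Function.update u k (t k)) := by
        funext k'
        by_cases h : k' = k
        · subst h; simp [hk]
        · by_cases h' : k' ∈ G <;> simp [h, h']
      by_cases h : u k = s k
      · simp +contextual [h, h1, h2]
      · simp [h]
  rw [eq_top_iff]
  intro M _
  rw [Matrix.matrix_eq_sum_single M]
  refine sum_mem fun s _ => sum_mem fun t _ => ?_
  have : Matrix.single s t (M s t) = M s t • (Matrix.of fun u v =>
      if (∀ k ∈ (Finset.univ : Finset K), u k = s k) ∧ v = Finset.univ.piecewise t u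
        then (1 : ℂ) else 0) := by
    ext u v
    simp [Matrix.single_apply, ← funext_iff, eq_comm]
  rw [this]
  exact Subalgebra.smul_mem _ (key _ s t) _

end MatrixModel

section SiteOp

variable {I : Type u} {σ : I → Type v}

open Classical in
theorem siteOp_apply (i : I) [Fintype (σ i)] (M : Matrix (σ i) (σ i) ℂ) (ψ : HilbertSpace σ)
    (s : Config σ) : siteOp i M ψ s = ∑ b, M (s i) b * ψ (Function.update s i b) := rfl

theorem siteOp_ext {T T' : HilbertSpace σ →L[ℂ] HilbertSpace σ} (h : ∀ ψ s, T ψ s = T' ψ s) :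
    T = T' :=
  ContinuousLinearMap.ext fun ψ => lp.ext (funext (h ψ))

theorem siteOp_mul (i : I) [Fintype (σ i)] (M N : Matrix (σ i) (σ i) ℂ) :
    siteOp i (M * N) = siteOp i M * siteOp i N := by
  classical
  refine siteOp_ext fun ψ s => ?_
  rw [mul_apply_eq_comp, siteOp_apply, siteOp_apply]
  simp only [siteOp_apply, Function.update_self, Function.update_idem, Matrix.mul_apply,
    Finset.sum_mul, Finset.mul_sum, mul_assoc]
  rw [Finset.sum_comm]

theorem siteOp_one (i : I) [Fintype (σ i)] [DecidableEq (σ i)] :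
    siteOp i (1 : Matrix (σ i) (σ i) ℂ) = 1 := by
  refine siteOp_ext fun ψ s => ?_
  rw [siteOp_apply]
  simp [Matrix.one_apply]

theorem siteOp_add (i : I) [Fintype (σ i)] (M N : Matrix (σ i) (σ i) ℂ) :
    siteOp i (M + N) = siteOp i M + siteOp i N := by
  refine siteOp_ext fun ψ s => ?_
  rw [add_apply, lp.coeFn_add, Pi.add_apply]
  simp only [siteOp_apply, Matrix.add_apply, add_mul, Finset.sum_add_distrib]

theorem siteOp_smul (i : I) [Fintype (σ i)] (z : ℂ) (M : Matrix (σ i) (σ i) ℂ) :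
    siteOp i (z • M) = z • siteOp i M := by
  refine siteOp_ext fun ψ s => ?_
  rw [smul_apply, lp.coeFn_smul, Pi.smul_apply]
  simp only [siteOp_apply, Matrix.smul_apply, smul_eq_mul, Finset.mul_sum, mul_assoc]

theorem siteOp_commute {i j : I} (hij : i ≠ j) [Fintype (σ i)] [Fintype (σ j)]
    (M : Matrix (σ i) (σ i) ℂ) (N : Matrix (σ j) (σ j) ℂ) :
    Commute (siteOp i M) (siteOp j N) := by
  classical
  refine siteOp_ext fun ψ s => ?_
  simp only [mul_apply_eq_comp, siteOp_apply, Function.update_of_ne hij,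
    Function.update_of_ne hij.symm, Finset.mul_sum]
  rw [Finset.sum_comm]
  refine Finset.sum_congr rfl fun b _ => Finset.sum_congr rfl fun a _ => ?_
  rw [Function.update_comm hij, mul_left_comm]

open Classical in
theorem siteOp_single (i : I) [Fintype (σ i)] (M : Matrix (σ i) (σ i) ℂ) (s : Config σ) :
    siteOp i M (lp.single 2 s 1) =
      ∑ a, M a (s i) • (lp.single 2 (Function.update s i a) (1 : ℂ) : HilbertSpace σ) := by
  refine lp.ext (funext fun t => ?_)
  obtain ⟨Q, hQ⟩ : ∃ Q : Prop, Q ↔ Function.update t i (s i) = s := ⟨_, Iff.rfl⟩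
  have hL : ∀ b, (Function.update t i b = s) ↔ (b = s i ∧ Q) := by
    refine fun b => ⟨?_, ?_⟩
    · rintro rfl; simp [hQ]
    · rintro ⟨rfl, h⟩; exact hQ.1 h
  have hR : ∀ a, (t = Function.update s i a) ↔ (a = t i ∧ Q) := by
    refine fun a => ⟨?_, ?_⟩
    · rintro rfl; simp [hQ]
    · rintro ⟨rfl, h⟩; rw [← hQ.1 h]; simp
  rw [siteOp_apply, lp.coeFn_sum, Finset.sum_apply]
  simp only [lp.coeFn_smul, Pi.smul_apply, lp.coeFn_single, Pi.single_apply, hL, hR]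
  by_cases h : Q <;> simp [h]

theorem siteOp_star (i : I) [Fintype (σ i)] (M : Matrix (σ i) (σ i) ℂ) :
    siteOp i (star M) = star (siteOp i M) := by
  classical
  refine siteOp_ext fun ψ s => ?_
  have h : ∀ (φ : HilbertSpace σ) (t : Config σ),
      φ t = inner ℂ (lp.single 2 t (1 : ℂ) : HilbertSpace σ) φ := by
    intro φ t
    rw [lp.inner_single_left]
    simp
  rw [ContinuousLinearMap.star_eq_adjoint, h (ContinuousLinearMap.adjoint _ ψ),
    ContinuousLinearMap.adjoint_inner_right, siteOp_single, siteOp_apply, sum_inner]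
  refine Finset.sum_congr rfl fun a _ => ?_
  rw [inner_smul_left, ← h, Matrix.star_apply]
  rfl

/-- Operators on a single site. -/
def siteHom (i : I) [Fintype (σ i)] [DecidableEq (σ i)] :
    Matrix (σ i) (σ i) ℂ →⋆ₐ[ℂ] (HilbertSpace σ →L[ℂ] HilbertSpace σ) where
  toFun := siteOp i
  map_one' := siteOp_one i
  map_mul' := siteOp_mul i
  map_zero' := by simpa using siteOp_smul i 0 (0 : Matrix (σ i) (σ i) ℂ)
  map_add' := siteOp_add i
  commutes' z := by
    rw [Algebra.algebraMap_eq_smul_one, siteOp_smul, siteOp_one, Algebra.algebraMap_eq_smul_one]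
  map_star' := siteOp_star i

end SiteOp

section QuditSystem

variable {I : Type u} (n : I → ℕ) (q : ℕ)

/-- The matrix units of a qudit, as bounded operators. -/
def quditOp (p : Σ i, Fin (n i)) (a b : Fin q) :
    HilbertSpace (quditBasis n q) →L[ℂ] HilbertSpace (quditBasis n q) :=
  siteOp (σ := quditBasis n q) p.1 (tensorUnit p.2 a b)

theorem quditOp_isMatrixUnits : IsMatrixUnits (quditOp n q) := by
  have h : ∀ i, IsMatrixUnits fun (k : Fin (n i)) (a b : Fin q) => quditOp n q ⟨i, k⟩ a b :=
    fun i => tensorUnit_isMatrixUnits.map (siteHom (σ := quditBasis n q) i)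
  refine ⟨fun p => (h p.1).mul_self p.2, fun p => (h p.1).sum_diag p.2, ?_,
    fun p => (h p.1).star_eq p.2⟩
  rintro ⟨i, k⟩ ⟨j, l⟩ hp a b c d
  by_cases hij : i = j
  · subst hij
    exact (h i).commute k l (fun hkl => hp (by rw [hkl])) a b c d
  · exact siteOp_commute (σ := quditBasis n q) hij _ _

theorem siteOp_mem_net (i : I) (M : Matrix (Fin (n i) → Fin q) (Fin (n i) → Fin q) ℂ) :
    siteOp (σ := quditBasis n q) i M ∈ net (quditOp n q) (Sigma.fst ⁻¹' {i}) := by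
  have hM : M ∈ net (tensorUnit : Fin (n i) → Fin q → Fin q → _) Set.univ := by
    rw [net_tensorUnit]; trivial
  exact map_mem_of_forall_unit (siteHom (σ := quditBasis n q) i)
    (fun k _ a b => unit_mem_net (e := quditOp n q) (p := ⟨i, k⟩) (by simp) a b) hM

theorem algebraOn_eq_net (J : Set I) : (algebraOn (quditBasis n q) J).toSubalgebra =
    net (quditOp n q) (Sigma.fst ⁻¹' J) := by
  refine le_antisymm ?_ (net_le fun p hp a b =>
    StarAlgebra.subset_adjoin ℂ _ ⟨p.1, hp, tensorUnit p.2 a b, rfl⟩)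
  intro T hT
  replace hT : T ∈ algebraOn (quditBasis n q) J := hT
  induction hT using StarAlgebra.adjoin_induction with
  | mem T hT =>
    obtain ⟨i, hi, M, rfl⟩ := hT
    refine net_mono ?_ (siteOp_mem_net n q i M)
    intro p hp
    rw [Set.mem_preimage, Set.mem_singleton_iff] at hp
    rwa [Set.mem_preimage, hp]
  | algebraMap r => exact Subalgebra.algebraMap_mem _ _
  | add x y hx hy ihx ihy => exact add_mem ihx ihy
  | mul x y hx hy ihx ihy => exact mul_mem ihx ihy
  | star x hx ih => exact star_mem_net (quditOp_isMatrixUnits n q).star_eq ih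

/-- The matrix units of a qudit, as local operators. -/
def quditUnit (p : Σ i, Fin (n i)) (a b : Fin q) : LocalAlgebra (quditBasis n q) :=
  ⟨quditOp n q p a b, StarAlgebra.subset_adjoin ℂ _ ⟨p.1, trivial, tensorUnit p.2 a b, rfl⟩⟩

theorem mem_net_quditUnit {K : Set (Σ i, Fin (n i))} {O : LocalAlgebra (quditBasis n q)} :
    O ∈ net (quditUnit n q) K ↔ (O : _ →L[ℂ] _) ∈ net (quditOp n q) K := by
  have h : net (quditOp n q) K = (net (quditUnit n q) K).map
      (LocalAlgebra (quditBasis n q)).toSubalgebra.val := by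
    unfold net
    rw [AlgHom.map_adjoin]
    congr 1
    ext T
    constructor
    · rintro ⟨p, hp, a, b, rfl⟩
      exact ⟨_, ⟨p, hp, a, b, rfl⟩, rfl⟩
    · rintro ⟨_, ⟨p, hp, a, b, rfl⟩, rfl⟩
      exact ⟨p, hp, a, b, rfl⟩
  rw [h, Subalgebra.mem_map]
  constructor
  · intro hO
    exact ⟨O, hO, rfl⟩
  · rintro ⟨O', hO', hOO'⟩
    rwa [← (Subtype.ext hOO' : O' = O)]

theorem supportedOn_iff {J : Set I} {O : LocalAlgebra (quditBasis n q)} :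
    SupportedOn O J ↔ O ∈ net (quditUnit n q) (Sigma.fst ⁻¹' J) := by
  rw [mem_net_quditUnit, ← algebraOn_eq_net]
  rfl

theorem quditUnit_isQuditAlgebra : IsQuditAlgebra (quditUnit n q) where
  units :=
    { mul_self := fun p a b c d => Subtype.ext (by
        refine ((quditOp_isMatrixUnits n q).mul_self p a b c d).trans ?_
        split_ifs <;> rfl)
      sum_diag := fun p => Subtype.ext (by
        refine Eq.trans ?_ ((quditOp_isMatrixUnits n q).sum_diag p)
        exact map_sum (LocalAlgebra (quditBasis n q)).toSubalgebra.val _ _)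
      commute := fun p p' h a b c d =>
        Subtype.ext ((quditOp_isMatrixUnits n q).commute p p' h a b c d).eq
      star_eq := fun p a b => Subtype.ext ((quditOp_isMatrixUnits n q).star_eq p a b) }
  gen := by
    rw [eq_top_iff]
    intro O _
    exact (supportedOn_iff n q (J := Set.univ)).1 O.2

theorem localAlgebra_nontrivial [NeZero q] : Nontrivial (LocalAlgebra (quditBasis n q)) := by
  classical
  refine ⟨⟨0, 1, fun h => ?_⟩⟩
  have h0 : (0 : HilbertSpace (quditBasis n q) →L[ℂ] HilbertSpace (quditBasis n q)) = 1 :=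
    congrArg Subtype.val h
  let s : Config (quditBasis n q) := fun _ _ => 0
  have h1 := congrArg (fun T => T (lp.single 2 s (1 : ℂ) : HilbertSpace (quditBasis n q)) s) h0
  simp at h1

theorem exists_pos_of_star_mul_self (g : LocalAlgebra (quditBasis n q)) (hg : g ≠ 0) (z : ℂ)
    (h : star g * g = algebraMap ℂ _ z) : ∃ r : ℝ, 0 < r ∧ z = r := by
  have hg' : (g : HilbertSpace (quditBasis n q) →L[ℂ] HilbertSpace (quditBasis n q)) ≠ 0 :=
    fun h0 => hg (Subtype.ext h0)
  obtain ⟨ψ, hψ⟩ : ∃ ψ, (g : HilbertSpace (quditBasis n q) →L[ℂ] HilbertSpace (quditBasis n q)) ψ ≠ 0 := by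
    by_contra! h0
    exact hg' (ContinuousLinearMap.ext h0)
  have hψ0 : ψ ≠ 0 := by rintro rfl; simp at hψ
  have h1 : star (g : HilbertSpace (quditBasis n q) →L[ℂ] HilbertSpace (quditBasis n q)) * g =
      algebraMap ℂ _ z := congrArg Subtype.val h
  have h2 : inner ℂ ψ ((star (g : HilbertSpace (quditBasis n q) →L[ℂ] HilbertSpace (quditBasis n q)) * g) ψ) =
      z * ((‖ψ‖ ^ 2 : ℝ) : ℂ) := by
    rw [h1, Algebra.algebraMap_eq_smul_one, smul_apply, one_apply_eq_self, inner_smul_right,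
      inner_self_eq_norm_sq_to_K]
    simp
  rw [mul_apply_eq_comp, ContinuousLinearMap.star_eq_adjoint,
    ContinuousLinearMap.adjoint_inner_right, inner_self_eq_norm_sq_to_K] at h2
  have hn : (‖ψ‖ ^ 2 : ℝ) ≠ 0 := by simpa using hψ0
  refine ⟨‖(g : HilbertSpace (quditBasis n q) →L[ℂ] HilbertSpace (quditBasis n q)) ψ‖ ^ 2 / ‖ψ‖ ^ 2, by positivity, ?_⟩
  rw [Complex.ofReal_div, eq_div_iff (by exact_mod_cast hn), ← h2]
  simp

end QuditSystem

section Round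

variable {I : Type u} [PseudoMetricSpace I] {n : I → ℕ} {q : ℕ}

theorem IsQCA.isLocal {R : ℝ} {α : Aut (quditBasis n q)} (hα : IsQCA R α) :
    IsLocal (quditUnit n q) Sigma.fst R α := by
  intro p a b
  have h1 : SupportedOn (quditUnit n q p a b) {p.1} :=
    (supportedOn_iff n q).2 (unit_mem_net (show p ∈ Sigma.fst ⁻¹' {p.1} from Set.mem_singleton _) a b)
  have h2 := (supportedOn_iff n q).1 (hα _ _ h1)
  refine net_mono ?_ h2
  rintro p' ⟨i, hi, h⟩
  rw [Set.mem_singleton_iff] at hi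
  subst hi
  exact h

theorem IsLocal.isQCA {R : ℝ} {α : Aut (quditBasis n q)}
    (hα : IsLocal (quditUnit n q) Sigma.fst R α) : IsQCA R α := by
  intro J O hO
  rw [supportedOn_iff] at hO ⊢
  exact hα.map_mem hO fun p hp p' hp' => ⟨p.1, hp, hp'⟩

/-- An automorphism that acts separately on disjoint finite systems is a round of gates. -/
theorem exists_round [NeZero q] {r : ℝ} (sets : Set (Set I)) (hdisj : sets.PairwiseDisjoint id)
    (hdiam : ∀ S ∈ sets, ∀ i ∈ S, ∀ j ∈ S, dist i j ≤ r)
    (hfin : ∀ S ∈ sets, (Sigma.fst ⁻¹' S : Set (Σ i, Fin (n i))).Finite)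
    (θ : Aut (quditBasis n q))
    (hθ : ∀ S ∈ sets, ∀ p : Σ i, Fin (n i), p.1 ∈ S → ∀ a b,
      θ (quditUnit n q p a b) ∈ net (quditUnit n q) (Sigma.fst ⁻¹' S))
    (hfix : ∀ p : Σ i, Fin (n i), (∀ S ∈ sets, p.1 ∉ S) → ∀ a b,
      θ (quditUnit n q p a b) = quditUnit n q p a b) :
    ∃ L : Round (quditBasis n q) r, L.Implements θ := by
  have := localAlgebra_nontrivial n q
  obtain ⟨g, hg, hgθ⟩ := (quditUnit_isQuditAlgebra n q).exists_gates
    (exists_pos_of_star_mul_self n q) sets hdisj hfin θ hθ hfix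
  exact ⟨{ sets := sets
           disjoint := hdisj
           diam_le := hdiam
           gate := g
           gate_unitary := fun S hS => (hg S hS).1
           gate_supported := fun S hS => (supportedOn_iff n q).2 (hg S hS).2 },
    fun J O hO l hnd hl hcov => hgθ J l hnd hl hcov O ((supportedOn_iff n q).1 hO)⟩

end Round

section Scale

/-- For large `ℓ` the shells of thickness `2 r` contain far fewer qudits than the balls of
radius `ℓ / 2`. -/
theorem exists_scale (c c' d : ℝ) (hc : 0 < c) (hc' : 0 < c') (hd : 0 < d) (r : ℕ) :
    ∃ ℓ : ℕ, 10 * r + 10 ≤ ℓ ∧ 1 ≤ ⌊c * ((ℓ : ℝ) / 2) ^ d⌋₊ ∧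
      (∑ t ∈ Finset.Icc 1 (7 * ℓ), ⌊c' * (t : ℝ) ^ (d - 1)⌋₊) *
        (∑ t ∈ Finset.Icc (ℓ - r + 1) (ℓ + r), ⌊c' * (t : ℝ) ^ (d - 1)⌋₊) ≤
          ⌊c * ((ℓ : ℝ) / 2) ^ d⌋₊ ^ 2 := by
  set δ := min 1 d with hδ
  have hδ0 : 0 < δ := lt_min one_pos hd
  have hδ1 : δ ≤ 1 := min_le_left _ _
  have hδd : δ ≤ d := min_le_right _ _
  set C := 7 * c' * 7 ^ (d - δ) * (2 * r * (c' * (2 ^ d * 2))) with hC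
  have ev1 : ∀ᶠ ℓ : ℕ in Filter.atTop, C / (c / 2 / 2 ^ d) ^ 2 ≤ (ℓ : ℝ) ^ δ :=
    ((tendsto_rpow_atTop hδ0).comp tendsto_natCast_atTop_atTop).eventually_ge_atTop _
  have ev2 : ∀ᶠ ℓ : ℕ in Filter.atTop, 2 / c * 2 ^ d ≤ (ℓ : ℝ) ^ d :=
    ((tendsto_rpow_atTop hd).comp tendsto_natCast_atTop_atTop).eventually_ge_atTop _
  obtain ⟨ℓ, h1, h2, h3⟩ := (ev1.and (ev2.and (Filter.eventually_ge_atTop (10 * r + 10)))).exists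
  have hℓ : (0 : ℝ) < ℓ := by exact_mod_cast (by omega : 0 < ℓ)
  have hhalf : ((ℓ : ℝ) / 2) ^ d = (ℓ : ℝ) ^ d / 2 ^ d := Real.div_rpow hℓ.le (by norm_num) d
  have h2d : (0 : ℝ) < 2 ^ d := by positivity
  have hbig : 2 ≤ c * ((ℓ : ℝ) / 2) ^ d := by
    rw [hhalf]
    have : 2 / c * 2 ^ d / 2 ^ d ≤ (ℓ : ℝ) ^ d / 2 ^ d := by gcongr
    rw [mul_div_assoc, div_self h2d.ne', mul_one] at this
    rw [div_le_iff₀ hc] at this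
    linarith
  have hA : c / 2 / 2 ^ d * (ℓ : ℝ) ^ d ≤ (⌊c * ((ℓ : ℝ) / 2) ^ d⌋₊ : ℝ) := by
    have := Nat.lt_floor_add_one (c * ((ℓ : ℝ) / 2) ^ d)
    have h4 : c / 2 / 2 ^ d * (ℓ : ℝ) ^ d = c * ((ℓ : ℝ) / 2) ^ d / 2 := by rw [hhalf]; ring
    linarith
  refine ⟨ℓ, h3, ?_, ?_⟩
  · exact Nat.le_floor (by norm_num; linarith)
  have hF : ((∑ t ∈ Finset.Icc 1 (7 * ℓ), ⌊c' * (t : ℝ) ^ (d - 1)⌋₊ : ℕ) : ℝ) ≤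
      7 * ℓ * (c' * (7 * (ℓ : ℝ)) ^ (d - δ)) := by
    push_cast
    have : ∀ t ∈ Finset.Icc 1 (7 * ℓ), ((⌊c' * (t : ℝ) ^ (d - 1)⌋₊ : ℕ) : ℝ) ≤
        c' * (7 * (ℓ : ℝ)) ^ (d - δ) := by
      intro t ht
      rw [Finset.mem_Icc] at ht
      have ht1 : (1 : ℝ) ≤ t := by exact_mod_cast ht.1
      have ht2 : (t : ℝ) ≤ 7 * ℓ := by exact_mod_cast ht.2
      refine (Nat.floor_le (by positivity)).trans ?_
      gcongr
      calc (t : ℝ) ^ (d - 1) ≤ (t : ℝ) ^ (d - δ) :=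
            Real.rpow_le_rpow_of_exponent_le ht1 (by linarith)
        _ ≤ _ := Real.rpow_le_rpow (by positivity) ht2 (by linarith)
    refine (Finset.sum_le_card_nsmul _ _ _ this).trans ?_
    simp
  have hN : ((∑ t ∈ Finset.Icc (ℓ - r + 1) (ℓ + r), ⌊c' * (t : ℝ) ^ (d - 1)⌋₊ : ℕ) : ℝ) ≤
      2 * r * (c' * (2 ^ d * (ℓ : ℝ) ^ d * 2 / ℓ)) := by
    push_cast
    have : ∀ t ∈ Finset.Icc (ℓ - r + 1) (ℓ + r), ((⌊c' * (t : ℝ) ^ (d - 1)⌋₊ : ℕ) : ℝ) ≤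
        c' * (2 ^ d * (ℓ : ℝ) ^ d * 2 / ℓ) := by
      intro t ht
      rw [Finset.mem_Icc] at ht
      have ht1 : (ℓ : ℝ) ≤ 2 * t := by exact_mod_cast (by omega : ℓ ≤ 2 * t)
      have ht2 : (t : ℝ) ≤ 2 * ℓ := by exact_mod_cast (by omega : t ≤ 2 * ℓ)
      have ht0 : (0 : ℝ) < t := by linarith
      refine (Nat.floor_le (by positivity)).trans ?_
      gcongr
      rw [Real.rpow_sub_one ht0.ne', ← Real.mul_rpow (by norm_num) hℓ.le, div_le_div_iff₀ ht0 hℓ]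
      have : (t : ℝ) ^ d ≤ (2 * (ℓ : ℝ)) ^ d := Real.rpow_le_rpow ht0.le ht2 hd.le
      calc (t : ℝ) ^ d * ℓ ≤ (2 * (ℓ : ℝ)) ^ d * (2 * t) := by gcongr
        _ = _ := by ring
    refine (Finset.sum_le_card_nsmul _ _ _ this).trans ?_
    rw [Nat.card_Icc, nsmul_eq_mul]
    refine mul_le_mul_of_nonneg_right ?_ (by positivity)
    have : ℓ + r + 1 - (ℓ - r + 1) = 2 * r := by omega
    rw [this]
    push_cast
    exact le_rfl
  have hfinal : 7 * ℓ * (c' * (7 * (ℓ : ℝ)) ^ (d - δ)) * (2 * r * (c' * (2 ^ d * (ℓ : ℝ) ^ d * 2 / ℓ)))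
      ≤ (c / 2 / 2 ^ d * (ℓ : ℝ) ^ d) ^ 2 := by
    have h5 : 7 * ℓ * (c' * (7 * (ℓ : ℝ)) ^ (d - δ)) *
        (2 * r * (c' * (2 ^ d * (ℓ : ℝ) ^ d * 2 / ℓ))) =
        C * ((ℓ : ℝ) ^ d) ^ 2 / (ℓ : ℝ) ^ δ := by
      rw [Real.mul_rpow (by norm_num) hℓ.le, Real.rpow_sub hℓ, hC]
      field_simp
    rw [h5, div_le_iff₀ (by positivity)]
    rw [div_le_iff₀ (by positivity)] at h1
    calc C * ((ℓ : ℝ) ^ d) ^ 2 ≤ ((ℓ : ℝ) ^ δ * (c / 2 / 2 ^ d) ^ 2) * ((ℓ : ℝ) ^ d) ^ 2 := by gcongr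
      _ = _ := by ring
  have : ((∑ t ∈ Finset.Icc 1 (7 * ℓ), ⌊c' * (t : ℝ) ^ (d - 1)⌋₊ : ℕ) : ℝ) *
      ((∑ t ∈ Finset.Icc (ℓ - r + 1) (ℓ + r), ⌊c' * (t : ℝ) ^ (d - 1)⌋₊ : ℕ) : ℝ) ≤
      (⌊c * ((ℓ : ℝ) / 2) ^ d⌋₊ : ℝ) ^ 2 :=
    (mul_le_mul hF hN (by positivity) (by positivity)).trans
      (hfinal.trans (pow_le_pow_left₀ (by positivity) hA 2))
  exact_mod_cast this

end Scale

section Packing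

variable {I P : Type*} [PseudoMetricSpace I]

theorem exists_maximal_separated (S : Set I) (L : ℝ) (hL : 0 ≤ L) :
    ∃ N ⊆ S, (∀ x ∈ N, ∀ y ∈ N, x ≠ y → L < dist x y) ∧ ∀ x ∈ S, ∃ y ∈ N, dist x y ≤ L := by
  obtain ⟨N, hN⟩ := zorn_subset {N : Set I | N ⊆ S ∧ N.Pairwise fun x y => L < dist x y} (by
    intro c hc hchain
    refine ⟨⋃₀ c, ⟨Set.sUnion_subset fun N hN => (hc hN).1, ?_⟩, fun N hN =>
      Set.subset_sUnion_of_mem hN⟩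
    exact (Set.pairwise_sUnion hchain.directedOn).2 fun N hN => (hc hN).2)
  refine ⟨N, hN.prop.1, fun x hx y hy h => hN.prop.2 hx hy h, fun x hx => ?_⟩
  by_contra! h
  have h1 : insert x N ∈ {N : Set I | N ⊆ S ∧ N.Pairwise fun x y => L < dist x y} := by
    refine ⟨Set.insert_subset hx hN.prop.1, hN.prop.2.insert fun y hy _ => ⟨h y hy, ?_⟩⟩
    rw [dist_comm]
    exact h y hy
  have h2 := hN.le_of_ge h1 (Set.subset_insert x N) (Set.mem_insert x N)
  have := h x h2
  rw [dist_self] at this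
  linarith

theorem exists_coloring (N : Set I) (L : ℝ) (M : ℕ)
    (hM : ∀ x ∈ N, {y ∈ N | dist y x ≤ L}.encard ≤ M) :
    ∃ col : I → ℕ, (∀ x ∈ N, col x < M + 1) ∧
      ∀ x ∈ N, ∀ y ∈ N, x ≠ y → col x = col y → L < dist x y := by
  classical
  let col : I → ℕ := (IsWellFounded.wf (r := (WellOrderingRel : I → I → Prop))).fix
    fun x f => sInf {k | ∀ y (h : WellOrderingRel y x), y ∈ N → dist y x ≤ L → f y h ≠ k}
  have hcol : ∀ x, col x = sInf {k | ∀ y, WellOrderingRel y x → y ∈ N → dist y x ≤ L → col y ≠ k} :=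
    fun x => WellFounded.fix_eq _ _ x
  have hex : ∀ x ∈ N, ∃ k < M + 1, ∀ y, WellOrderingRel y x → y ∈ N → dist y x ≤ L → col y ≠ k := by
    intro x hx
    have hfin : {y ∈ N | dist y x ≤ L}.Finite := Set.finite_of_encard_le_coe (hM x hx)
    have hcard : (hfin.toFinset.image col).card < (Finset.range (M + 1)).card := by
      rw [Finset.card_range, Nat.lt_succ_iff]
      refine Finset.card_image_le.trans ?_
      have := hM x hx
      rw [hfin.encard_eq_coe_toFinset_card] at this
      exact_mod_cast this
    obtain ⟨k, hk, hk'⟩ := Finset.exists_mem_notMem_of_card_lt_card hcard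
    refine ⟨k, Finset.mem_range.1 hk, fun y _ hy hyx h => hk' ?_⟩
    exact Finset.mem_image.2 ⟨y, by simpa using ⟨hy, hyx⟩, h⟩
  have hne : ∀ x ∈ N, ∀ y ∈ N, WellOrderingRel y x → dist y x ≤ L → col y ≠ col x := by
    intro x hx y hy hyx hd
    obtain ⟨k, -, hk⟩ := hex x hx
    have := Nat.sInf_mem (s := {k | ∀ y, WellOrderingRel y x → y ∈ N → dist y x ≤ L → col y ≠ k})
      ⟨k, hk⟩
    rw [← hcol] at this
    exact this y hyx hy hd
  refine ⟨col, fun x hx => ?_, fun x hx y hy hxy h => ?_⟩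
  · obtain ⟨k, hkM, hk⟩ := hex x hx
    rw [hcol]
    exact (Nat.sInf_le (show k ∈ {k | ∀ y, WellOrderingRel y x → y ∈ N → dist y x ≤ L →
      col y ≠ k} from hk)).trans_lt hkM
  · by_contra! hd
    rcases trichotomous_of WellOrderingRel x y with h' | h' | h'
    · exact hne y hy x hx h' hd h
    · exact hxy h'
    · exact hne x hx y hy h' (by rwa [dist_comm]) h.symm

theorem packing {s : P → I} {N : Set I} {ℓ : ℝ} (hN : ∀ x ∈ N, ∀ y ∈ N, x ≠ y → ℓ < dist x y)
    {A F : ℕ} (hA : ∀ x, (A : ℕ∞) ≤ {p | dist x (s p) ≤ ℓ / 2}.encard) (hA1 : 1 ≤ A) (z : I)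
    {L L' : ℝ} (hL : L + ℓ / 2 ≤ L') (hF : {p | dist z (s p) ≤ L'}.encard ≤ F) :
    {x ∈ N | dist x z ≤ L}.Finite ∧ {x ∈ N | dist x z ≤ L}.ncard * A ≤ F := by
  classical
  have hfin : {p | dist z (s p) ≤ L'}.Finite := Set.finite_of_encard_le_coe hF
  have hsub : ∀ x, dist x z ≤ L → {p | dist x (s p) ≤ ℓ / 2} ⊆ {p | dist z (s p) ≤ L'} := by
    intro x hx p hp
    have h1 : dist x (s p) ≤ ℓ / 2 := hp
    have := dist_triangle z x (s p)
    rw [dist_comm z x] at this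
    change dist z (s p) ≤ L'
    linarith
  have key : ∀ G : Finset I, (G : Set I) ⊆ {x ∈ N | dist x z ≤ L} → G.card * A ≤ F := by
    intro G hG
    let T : I → Finset P := fun x => hfin.toFinset.filter fun p => dist x (s p) ≤ ℓ / 2
    have hT : ∀ x ∈ G, A ≤ (T x).card := by
      intro x hx
      have h1 := hA x
      have h2 : {p | dist x (s p) ≤ ℓ / 2} = (T x : Set P) := by
        ext p
        simp only [T, Finset.coe_filter, Set.Finite.mem_toFinset, Set.mem_ofPred_eq]
        exact ⟨fun h => ⟨hsub x (hG hx).2 h, h⟩, fun h => h.2⟩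
      rw [h2, Set.encard_coe_eq_coe_finsetCard] at h1
      exact_mod_cast h1
    have hdisj : (G : Set I).PairwiseDisjoint T := by
      intro x hx y hy hxy
      rw [Function.onFun, Finset.disjoint_left]
      intro p hp hp'
      have h1 := hN x (hG hx).1 y (hG hy).1 hxy
      have h2 : dist x (s p) ≤ ℓ / 2 := (Finset.mem_filter.1 hp).2
      have h3 : dist y (s p) ≤ ℓ / 2 := (Finset.mem_filter.1 hp').2
      have := dist_triangle_right x y (s p)
      linarith
    calc G.card * A ≤ ∑ x ∈ G, (T x).card := by
          rw [← smul_eq_mul]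
          exact Finset.card_nsmul_le_sum _ _ _ hT
      _ = (G.biUnion T).card := (Finset.card_biUnion hdisj).symm
      _ ≤ hfin.toFinset.card := Finset.card_le_card (Finset.biUnion_subset.2 fun x _ =>
          Finset.filter_subset _ _)
      _ ≤ F := by
        rw [hfin.encard_eq_coe_toFinset_card] at hF
        exact_mod_cast hF
  have hfinite : {x ∈ N | dist x z ≤ L}.Finite := by
    by_contra h
    obtain ⟨G, hG, hcard⟩ := Set.Infinite.exists_subset_card_eq h (F + 1)
    have h1 := key G hG
    rw [hcard] at h1
    nlinarith
  refine ⟨hfinite, ?_⟩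
  rw [Set.ncard_eq_toFinset_card _ hfinite]
  exact key _ (by simp)

omit [PseudoMetricSpace I] in
/-- Fibrewise injections into disjoint sets. -/
theorem exists_injOn {D : Set P} (f : P → I) (T : I → Set P)
    (hT : ∀ p ∈ D, ∀ p' ∈ D, f p ≠ f p' → Disjoint (T (f p)) (T (f p')))
    (hfin : ∀ p ∈ D, {p' ∈ D | f p' = f p}.Finite)
    (hcard : ∀ p ∈ D, {p' ∈ D | f p' = f p}.encard ≤ (T (f p)).encard) :
    ∃ j : P → P, Set.InjOn j D ∧ ∀ p ∈ D, j p ∈ T (f p) := by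
  classical
  rcases isEmpty_or_nonempty P with hP | hP
  · exact ⟨id, fun p => (hP.false p).elim, fun p => (hP.false p).elim⟩
  have h : ∀ z, ∃ g : P → P, ∀ p ∈ D, f p = z →
      ({p' ∈ D | f p' = z} ⊆ g ⁻¹' (T z) ∧ Set.InjOn g {p' ∈ D | f p' = z}) := by
    intro z
    by_cases hz : ∃ p ∈ D, f p = z
    · obtain ⟨p, hp, rfl⟩ := hz
      obtain ⟨g, hg⟩ := (hfin p hp).exists_injOn_of_encard_le (hcard p hp)
      exact ⟨g, fun _ _ _ => hg⟩
    · exact ⟨id, fun p hp hpz => absurd ⟨p, hp, hpz⟩ hz⟩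
  choose g hg using h
  refine ⟨fun p => g (f p) p, ?_, fun p hp => (hg (f p) p hp rfl).1 ⟨hp, rfl⟩⟩
  intro p hp p' hp' hpp'
  by_cases hff : f p = f p'
  · refine (hg (f p) p hp rfl).2 ⟨hp, rfl⟩ ⟨hp', hff.symm⟩ ?_
    change g (f p) p = g (f p') p' at hpp'
    rw [hpp', hff]
  · have h1 : g (f p) p ∈ T (f p) := (hg (f p) p hp rfl).1 ⟨hp, rfl⟩
    have h2 : g (f p') p' ∈ T (f p') := (hg (f p') p' hp' rfl).1 ⟨hp', rfl⟩
    change g (f p) p = g (f p') p' at hpp'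
    rw [hpp'] at h1
    exact absurd h2 (Set.disjoint_left.1 (hT p hp p' hp' hff) h1)

end Packing

section Geometry

variable {I P : Type*} [PseudoMetricSpace I]

omit [PseudoMetricSpace I] in
theorem encard_biUnion_le_card_mul (G : Finset I) (S : I → Set P) (k : ℕ)
    (h : ∀ x ∈ G, (S x).encard ≤ k) : (⋃ x ∈ G, S x).encard ≤ ((G.card * k : ℕ) : ℕ∞) := by
  classical
  induction G using Finset.induction_on with
  | empty => simp
  | insert x G hx ih =>
    rw [Finset.set_biUnion_insert, Finset.card_insert_of_notMem hx]
    refine (Set.encard_union_le _ _).trans ?_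
    have h1 := add_le_add (h x (by simp)) (ih fun y hy => h y (Finset.mem_insert_of_mem hy))
    refine h1.trans (le_of_eq ?_)
    push_cast
    ring

theorem encard_shell_le {s : P → I} {Λ : ℕ} {b : ℕ → ℕ} {x : I}
    (hb : ∀ t : ℕ, 1 ≤ t → t ≤ Λ →
      {p | (t : ℝ) - 1 ≤ dist x (s p) ∧ dist x (s p) ≤ t}.encard ≤ b t)
    (m k : ℕ) (hmk : m < k) (hk : k ≤ Λ) :
    {p | (m : ℝ) ≤ dist x (s p) ∧ dist x (s p) ≤ k}.encard ≤
      ((∑ t ∈ Finset.Icc (m + 1) k, b t : ℕ) : ℕ∞) := by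
  induction k, (show m + 1 ≤ k from hmk) using Nat.le_induction with
  | base =>
    have := hb (m + 1) (by omega) hk
    simpa using this
  | succ k hmk' ih =>
    rw [Finset.sum_Icc_succ_top (by omega)]
    have h1 := hb (k + 1) (by omega) hk
    have h2 := add_le_add (ih (by omega) (by omega)) h1
    rw [Nat.cast_add]
    refine le_trans ?_ h2
    refine le_trans (Set.encard_le_encard ?_) (Set.encard_union_le _ _)
    intro p hp
    obtain ⟨hp1, hp2⟩ := hp
    rcases le_total (dist x (s p)) k with h | h
    · exact Or.inl ⟨hp1, h⟩
    · refine Or.inr ⟨?_, by exact_mod_cast hp2⟩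
      push_cast
      linarith

theorem encard_ball_le {s : P → I} {Λ : ℕ} {b : ℕ → ℕ} {x : I}
    (hb : ∀ t : ℕ, 1 ≤ t → t ≤ Λ →
      {p | (t : ℝ) - 1 ≤ dist x (s p) ∧ dist x (s p) ≤ t}.encard ≤ b t)
    (k : ℕ) (hk0 : 0 < k) (hk : k ≤ Λ) :
    {p | dist x (s p) ≤ k}.encard ≤ ((∑ t ∈ Finset.Icc 1 k, b t : ℕ) : ℕ∞) := by
  simpa [dist_nonneg] using encard_shell_le hb 0 k hk0 hk

/-- A covering by balls of radius `ℓ`, coloured such that balls of the same colour are far apart,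
together with an injective assignment of the qudits near the boundaries of these balls to qudits
near the centers of a sparse collection of these balls. -/
theorem exists_covering (s : P → I) {r ℓ Λ L A : ℕ} {b : ℕ → ℕ} (hr : 1 ≤ r)
    (hrℓ : 10 * r + 10 ≤ ℓ)
    (hΛ : 7 * ℓ ≤ Λ) (hΛ' : L + ℓ ≤ Λ)
    (hA : ∀ x, (A : ℕ∞) ≤ {p | dist x (s p) ≤ (ℓ : ℝ) / 2}.encard) (hA1 : 1 ≤ A)
    (hb : ∀ x, ∀ t : ℕ, 1 ≤ t → t ≤ Λ →
      {p | (t : ℝ) - 1 ≤ dist x (s p) ∧ dist x (s p) ≤ t}.encard ≤ b t)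
    (hscale : (∑ t ∈ Finset.Icc 1 (7 * ℓ), b t) * (∑ t ∈ Finset.Icc (ℓ - r + 1) (ℓ + r), b t) ≤
      A ^ 2) :
    ∃ (N N₀ : Set I) (col : I → ℕ) (D : Set P) (j : P → P),
      N₀ ⊆ N ∧ (∀ i, ∃ x ∈ N, dist i x ≤ ℓ) ∧
      (∀ x ∈ N, col x < ∑ t ∈ Finset.Icc 1 (L + ℓ), b t + 1) ∧
      (∀ x ∈ N, ∀ y ∈ N, x ≠ y → col x = col y → L < dist x y) ∧
      (∀ z ∈ N₀, ∀ z' ∈ N₀, z ≠ z' → 2 * (ℓ : ℝ) + 4 * r < dist z z') ∧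
      (∀ p, p ∈ D ↔ ∃ x ∈ N, (ℓ : ℝ) - r ≤ dist x (s p) ∧ dist x (s p) ≤ ℓ + r) ∧
      Set.InjOn j D ∧
      ∀ p ∈ D, ∃ z ∈ N₀, dist (s (j p)) z ≤ (ℓ : ℝ) / 2 ∧ dist (s p) z ≤ 3 * ℓ + 5 * r ∧
        ∀ z' ∈ N₀, dist (s p) z' ≤ ℓ + 2 * r → z' = z := by
  classical
  have hrℓ' : 10 * (r : ℝ) + 10 ≤ ℓ := by exact_mod_cast hrℓ
  have hr0 : (0 : ℝ) ≤ r := Nat.cast_nonneg r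
  obtain ⟨N, -, hN, hcov⟩ := exists_maximal_separated (Set.univ : Set I) ℓ (Nat.cast_nonneg _)
  obtain ⟨N₀, hN₀N, hN₀, hcov₀⟩ := exists_maximal_separated N (2 * (ℓ : ℝ) + 4 * r) (by positivity)
  obtain ⟨col, hcol, hcol'⟩ := exists_coloring N L (∑ t ∈ Finset.Icc 1 (L + ℓ), b t) (by
    intro x _
    obtain ⟨h1, h2⟩ := packing hN hA hA1 x (L := L) (L' := ((L + ℓ : ℕ) : ℝ)) (by
      push_cast; linarith) (encard_ball_le (hb x) (L + ℓ) (by omega) hΛ')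
    rw [← h1.cast_ncard_eq]
    exact_mod_cast (Nat.le_mul_of_pos_right _ hA1).trans h2)
  set D : Set P := {p | ∃ x ∈ N, (ℓ : ℝ) - r ≤ dist x (s p) ∧ dist x (s p) ≤ ℓ + r} with hD
  have hf : ∀ p, ∃ z, p ∈ D → z ∈ N₀ ∧ dist (s p) z ≤ 3 * ℓ + 5 * r ∧
      ∀ z' ∈ N₀, dist (s p) z' ≤ ℓ + 2 * r → z' = z := by
    intro p
    by_cases h : ∃ z ∈ N₀, dist (s p) z ≤ ℓ + 2 * r
    · obtain ⟨z, hz, hpz⟩ := h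
      refine ⟨z, fun _ => ⟨hz, by linarith, fun z' hz' hpz' => ?_⟩⟩
      by_contra hne
      have h1 := hN₀ z' hz' z hz hne
      have h2 := dist_triangle_left z' z (s p)
      linarith
    · by_cases hp : p ∈ D
      · obtain ⟨x, hx, hx1, hx2⟩ := hp
        obtain ⟨z, hz, hxz⟩ := hcov₀ x hx
        refine ⟨z, fun _ => ⟨hz, ?_, fun z' hz' hpz' => absurd ⟨z', hz', hpz'⟩ h⟩⟩
        have := dist_triangle_left (s p) z x
        linarith
      · exact ⟨s p, fun h => absurd h hp⟩
  choose f hf using hf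
  set Nsh := ∑ t ∈ Finset.Icc (ℓ - r + 1) (ℓ + r), b t with hNsh
  have hfiber : ∀ p ∈ D, {p' ∈ D | f p' = f p}.encard ≤ A := by
    intro p hp
    obtain ⟨hX, hXA⟩ := packing hN hA hA1 (f p) (L := 4 * ℓ + 6 * r) (L' := ((7 * ℓ : ℕ) : ℝ)) (by
      push_cast; linarith) (encard_ball_le (hb (f p)) (7 * ℓ) (by omega) hΛ)
    have hsub : {p' ∈ D | f p' = f p} ⊆ ⋃ x ∈ hX.toFinset,
        {p' | ((ℓ - r : ℕ) : ℝ) ≤ dist x (s p') ∧ dist x (s p') ≤ ((ℓ + r : ℕ) : ℝ)} := by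
      rintro p' ⟨hp', hfp'⟩
      obtain ⟨-, hd, -⟩ := hf p' hp'
      obtain ⟨x, hx, hx1, hx2⟩ := hp'
      rw [hfp'] at hd
      simp only [Set.mem_iUnion]
      refine ⟨x, ?_, ?_⟩
      · rw [Set.Finite.mem_toFinset]
        refine ⟨hx, ?_⟩
        have := dist_triangle x (s p') (f p)
        linarith
      · rw [Set.mem_ofPred_eq, Nat.cast_sub (by omega), Nat.cast_add]
        exact ⟨hx1, hx2⟩
    refine (Set.encard_le_encard hsub).trans ((encard_biUnion_le_card_mul _ _ Nsh ?_).trans ?_)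
    · intro x _
      exact encard_shell_le (hb x) (ℓ - r) (ℓ + r) (by omega) (by omega)
    · rw [← Set.ncard_eq_toFinset_card _ hX]
      have : {x ∈ N | dist x (f p) ≤ 4 * ℓ + 6 * r}.ncard * Nsh * A ≤ A * A := by
        calc _ = {x ∈ N | dist x (f p) ≤ 4 * ℓ + 6 * r}.ncard * A * Nsh := by ring
          _ ≤ _ := (Nat.mul_le_mul_right _ hXA).trans (hscale.trans_eq (sq A))
      exact_mod_cast Nat.le_of_mul_le_mul_right this hA1
  obtain ⟨j, hj, hjT⟩ := exists_injOn f (fun z => {p | dist z (s p) ≤ (ℓ : ℝ) / 2}) (D := D)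
    (by
      intro p hp p' hp' hne
      rw [Set.disjoint_left]
      intro p'' h1 h2
      have h3 := hN₀ _ (hf p hp).1 _ (hf p' hp').1 hne
      have h4 := dist_triangle_right (f p) (f p') (s p'')
      have h5 : dist (f p) (s p'') ≤ (ℓ : ℝ) / 2 := h1
      have h6 : dist (f p') (s p'') ≤ (ℓ : ℝ) / 2 := h2
      linarith)
    (fun p hp => Set.finite_of_encard_le_coe (hfiber p hp))
    (fun p hp => (hfiber p hp).trans (hA _))
  refine ⟨N, N₀, col, D, j, hN₀N, fun i => hcov i trivial, hcol, hcol', hN₀, fun p => Iff.rfl, hj,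
    fun p hp => ⟨f p, (hf p hp).1, ?_, (hf p hp).2⟩⟩
  rw [dist_comm]
  exact hjT p hp

end Geometry

section Regions

variable {I P : Type*} [PseudoMetricSpace I] {s : P → I} {N N₀ : Set I} {D : Set P} {j : P → P}
  {r ℓ : ℝ}

/-- The union of the balls of radius `ℓ` with centers in `N'`, without the balls with centers
in `N₀`. -/
def region (ℓ : ℝ) (N₀ N' : Set I) : Set I := {i | (∃ x ∈ N', dist i x ≤ ℓ) ∧ ∀ z ∈ N₀, ℓ < dist i z}

theorem admissible_region (hN₀ : N₀ ⊆ N) (hr : 2 * r ≤ ℓ)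
    (hD : ∀ p, p ∈ D ↔ ∃ x ∈ N, ℓ - r ≤ dist x (s p) ∧ dist x (s p) ≤ ℓ + r)
    (hj : ∀ p ∈ D, ∃ z ∈ N₀, dist (s (j p)) z ≤ ℓ / 2) {N' : Set I} (hN' : N' ⊆ N) :
    Admissible s r D j (region ℓ N₀ N') := by
  refine ⟨fun p hp => ?_, fun p hp i hi h => ?_⟩
  · have key : ∀ x ∈ N, ∀ i, dist i (s p) ≤ r → (dist i x ≤ ℓ ↔ dist (s p) x ≤ ℓ) := by
      intro x hx i hi
      rw [hD] at hp
      push Not at hp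
      have h1 := dist_triangle i (s p) x
      have h2 := dist_triangle_left (s p) x i
      have h3 := hp x hx
      rw [dist_comm x] at h3
      constructor
      · intro h
        by_contra! h'
        have := h3 (by linarith)
        linarith
      · intro h
        by_contra! h'
        have := h3 (by linarith)
        linarith
    have key' : ∀ i, dist i (s p) ≤ r → (i ∈ region ℓ N₀ N' ↔ s p ∈ region ℓ N₀ N') := by
      intro i hi
      refine and_congr (exists_congr fun x => and_congr_right fun hx => key x (hN' hx) i hi)
        (forall₂_congr fun z hz => ?_)
      rw [← not_le, ← not_le, key z (hN₀ hz) i hi]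
    by_cases h : s p ∈ region ℓ N₀ N'
    · exact Or.inl fun i hi => (key' i hi).2 h
    · exact Or.inr fun i hi h' => h ((key' i hi).1 h')
  · obtain ⟨z, hz, hjz⟩ := hj p hp
    have h1 := h.2 z hz
    have h2 := dist_triangle i (s (j p)) z
    linarith

end Regions

section Factorization

variable {P κ A B I : Type*} [Fintype κ] [DecidableEq κ] [Nonempty κ] [PseudoMetricSpace I]
  [Ring A] [StarRing A] [Algebra ℂ A] [Ring B] [StarRing B] [Algebra ℂ B]
  [StarModule ℂ A] [StarModule ℂ B] [Nontrivial A] [Nontrivial B]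
  {e : P → κ → κ → A} {E : P ⊕ P → κ → κ → B} {s : P → I}

/-- An automorphism that acts separately on disjoint finite systems of diameter at most `r`. -/
def IsBlockwise (e : P → κ → κ → A) (s : P → I) (r : ℝ) (θ : A ≃⋆ₐ[ℂ] A) : Prop :=
  ∃ sets : Set (Set I), sets.PairwiseDisjoint id ∧
    (∀ S ∈ sets, ∀ i ∈ S, ∀ j ∈ S, dist i j ≤ r) ∧ (∀ S ∈ sets, (s ⁻¹' S).Finite) ∧
    (∀ S ∈ sets, ∀ p, s p ∈ S → ∀ a b, θ (e p a b) ∈ net e (s ⁻¹' S)) ∧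
    ∀ p, (∀ S ∈ sets, s p ∉ S) → ∀ a b, θ (e p a b) = e p a b

/-- The commutator of two local automorphisms is a product of boundedly many blockwise
automorphisms. -/
theorem exists_blockwise_factorization (he : IsQuditAlgebra e) (hE : IsQuditAlgebra E)
    {R : ℝ} {r ℓ Λ L t m : ℕ} {b : ℕ → ℕ} (hr : 1 ≤ r) (hR : 6 * R ≤ r)
    (ht : t = 4 * ℓ + 5 * r) (hL : L = 2 * (ℓ + 2 * (r + 2 * t)))
    (hΛ : L + ℓ ≤ Λ) (hrℓ : 10 * r + 10 ≤ ℓ)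
    (hA : ∀ x, (m : ℕ∞) ≤ {p | dist x (s p) ≤ (ℓ : ℝ) / 2}.encard) (hA1 : 1 ≤ m)
    (hb : ∀ x, ∀ t : ℕ, 1 ≤ t → t ≤ Λ →
      {p | (t : ℝ) - 1 ≤ dist x (s p) ∧ dist x (s p) ≤ t}.encard ≤ b t)
    (hscale : (∑ t ∈ Finset.Icc 1 (7 * ℓ), b t) * (∑ t ∈ Finset.Icc (ℓ - r + 1) (ℓ + r), b t) ≤
      m ^ 2) {α β : A ≃⋆ₐ[ℂ] A} (hα : IsLocal e s R α) (hβ : IsLocal e s R β) :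
    ∃ l : List (A ≃⋆ₐ[ℂ] A), l.length = ∑ t ∈ Finset.Icc 1 (L + ℓ), b t + 2 ∧
      (∀ θ ∈ l, IsBlockwise e s L θ) ∧ l.prod = α * β * α⁻¹ * β⁻¹ := by
  classical
  have hrℓ' : 10 * (r : ℝ) + 10 ≤ ℓ := by exact_mod_cast hrℓ
  have hr1 : (1 : ℝ) ≤ r := by exact_mod_cast hr
  have ht' : (t : ℝ) = 4 * ℓ + 5 * r := by exact_mod_cast ht
  have hL' : (L : ℝ) = 2 * (ℓ + 2 * (r + 2 * t)) := by exact_mod_cast hL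
  obtain ⟨N, N₀, col, D, j, hN₀N, hcov, hcol, hcol', hN₀, hD, hj, hjz⟩ :=
    exists_covering s hr hrℓ (by omega) hΛ hA hA1 hb hscale
  set M := ∑ t ∈ Finset.Icc 1 (L + ℓ), b t with hM
  have hR6 : 6 * ((r : ℝ) / 6) = r := by ring
  have hRr : R ≤ (r : ℝ) / 6 := by linarith
  have hαl := hα.mono hRr
  have hβl := hβ.mono hRr
  obtain ⟨v, hv0, hvcongr, hvin, hvnear⟩ := exists_interpolation he hE s (R := (r : ℝ) / 6) (t := t)
    (by positivity) hαl hβl D j hj (by positivity) (by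
      intro p hp
      obtain ⟨z, -, h1, h2, -⟩ := hjz p hp
      have := dist_triangle_right (s (j p)) (s p) z
      linarith)
  rw [hR6] at hvcongr hvin hvnear
  have hadm : ∀ {N' : Set I}, N' ⊆ N → Admissible s (r : ℝ) D j (region ℓ N₀ N') :=
    fun hN' => admissible_region hN₀N (by linarith) hD (fun p hp => by
      obtain ⟨z, hz, h1, -⟩ := hjz p hp
      exact ⟨z, hz, h1⟩) hN'
  have hballfin : ∀ (x : I) (ρ : ℝ), ρ ≤ L → {p : P | dist x (s p) ≤ ρ}.Finite := by
    intro x ρ hρ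
    refine Set.Finite.subset (Set.finite_of_encard_le_coe
      (encard_ball_le (hb x) L (by omega) (by omega))) ?_
    intro p hp
    exact le_trans hp hρ
  set ρ : ℝ := ℓ + 2 * (r + 2 * t) with hρ
  let Nk : ℕ → Set I := fun k => {x ∈ N | col x < k}
  have hNk : ∀ k, Nk k ⊆ N := fun k x hx => hx.1
  let V : ℕ → A ≃⋆ₐ[ℂ] A := fun k => v (region ℓ N₀ (Nk k))
  have hstep : ∀ k, IsBlockwise e s L (V (k + 1) * (V k)⁻¹) := by
    intro k
    have hfar : ∀ N' ⊆ N, Nk k ⊆ N' → ∀ p : P,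
        (∀ x ∈ N', x ∉ Nk k → ρ < dist (s p) x) → ∀ a b,
        (v (region ℓ N₀ N') * (V k)⁻¹) (e p a b) = e p a b := by
      intro N' hN' hkN' p hp a b
      rw [hvcongr _ _ _ (hadm (hNk k)) (hadm hN') (hadm (hNk k)) p ?_ a b]
      · change (V k * (V k)⁻¹) _ = _
        rw [mul_inv_cancel]
        rfl
      · intro i hi
        refine and_congr_left fun _ => ⟨?_, fun ⟨x, hx, h⟩ => ⟨x, hkN' hx, h⟩⟩
        rintro ⟨x, hx, hix⟩
        by_cases hxk : x ∈ Nk k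
        · exact ⟨x, hxk, hix⟩
        · have h1 := hp x hx hxk
          have h2 := dist_triangle_left (s p) x i
          linarith
    refine ⟨{S | ∃ x ∈ N, col x = k ∧ S = Metric.closedBall x ρ}, ?_, ?_, ?_, ?_, ?_⟩
    · rintro _ ⟨x, hx, hxk, rfl⟩ _ ⟨y, hy, hyk, rfl⟩ hne
      have hxy : x ≠ y := by rintro rfl; exact hne rfl
      have := hcol' x hx y hy hxy (hxk.trans hyk.symm)
      exact Metric.closedBall_disjoint_closedBall (by linarith)
    · rintro _ ⟨x, hx, hxk, rfl⟩ i hi i' hi'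
      rw [Metric.mem_closedBall] at hi hi'
      have := dist_triangle_right i i' x
      linarith
    · rintro _ ⟨x, hx, hxk, rfl⟩
      refine (hballfin x ρ (by linarith [Nat.cast_nonneg (α := ℝ) t])).subset ?_
      intro p hp
      rw [Set.mem_preimage, Metric.mem_closedBall'] at hp
      exact hp
    · rintro _ ⟨x, hx, hxk, rfl⟩ p hp a b
      have hsub : Nk k ⊆ insert x (Nk k) := Set.subset_insert _ _
      have hsubN : insert x (Nk k) ⊆ N := Set.insert_subset hx (hNk k)
      have h1 : (V (k + 1) * (V k)⁻¹) (e p a b) =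
          (v (region ℓ N₀ (insert x (Nk k))) * (V k)⁻¹) (e p a b) := by
        refine hvcongr _ _ _ (hadm (hNk k)) (hadm (hNk (k + 1))) (hadm hsubN) p ?_ a b
        intro i hi
        refine and_congr_left fun _ => ⟨?_, ?_⟩
        · rintro ⟨y, hy, hiy⟩
          refine ⟨y, ?_, hiy⟩
          by_cases hyk : y ∈ Nk k
          · exact hsub hyk
          · refine Set.mem_insert_iff.2 (Or.inl ?_)
            by_contra hyx
            have hyk' : col y = k := by
              have h2 : col y < k + 1 := hy.2
              have h3 : ¬ col y < k := fun h => hyk ⟨hy.1, h⟩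
              omega
            have h4 := hcol' y hy.1 x hx hyx (hyk'.trans hxk.symm)
            rw [Metric.mem_closedBall] at hp
            have h5 := dist_triangle_left y x i
            have h6 := dist_triangle i (s p) x
            linarith
        · rintro ⟨y, hy, hiy⟩
          refine ⟨y, ?_, hiy⟩
          rcases hy with rfl | hy
          · exact ⟨hx, by omega⟩
          · exact ⟨hy.1, hy.2.trans (Nat.lt_succ_self k)⟩
      rw [h1, he.mem_net_iff]
      intro p' hp' c d
      have h2 := hfar _ hsubN hsub p' (by
        intro y hy hyk
        rcases hy with rfl | hy
        · rw [Set.mem_preimage, Metric.mem_closedBall, not_le] at hp'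
          exact hp'
        · exact absurd hy hyk) c d
      rw [← h2]
      refine Commute.map ?_ _
      refine he.units.commute _ _ ?_ a b c d
      rintro rfl
      exact hp' hp
    · intro p hp a b
      refine hfar _ (hNk (k + 1)) (fun x hx => ⟨hx.1, hx.2.trans (Nat.lt_succ_self k)⟩) p ?_ a b
      intro x hx hxk
      have hk : col x = k := by
        have h2 : col x < k + 1 := hx.2
        have h3 : ¬ col x < k := fun h => hxk ⟨hx.1, h⟩
        omega
      have := hp _ ⟨x, hx.1, hk, rfl⟩
      rwa [Metric.mem_closedBall, not_le] at this
  have hV : ∀ k, ∃ l : List (A ≃⋆ₐ[ℂ] A),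
      l.length = k ∧ (∀ θ ∈ l, IsBlockwise e s L θ) ∧ l.prod = V k := by
    intro k
    induction k with
    | zero =>
      refine ⟨[], rfl, by simp, ?_⟩
      have : region (ℓ : ℝ) N₀ (Nk 0) = ∅ := by
        ext i
        simp [region, Nk]
      change _ = v _
      rw [this, hv0, List.prod_nil]
    | succ k ih =>
      obtain ⟨l, hlen, hl, hprod⟩ := ih
      refine ⟨(V (k + 1) * (V k)⁻¹) :: l, by simp [hlen], ?_, ?_⟩
      · rintro θ (_ | ⟨_, hθ⟩)
        · exact hstep k
        · exact hl θ hθ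
      · rw [List.prod_cons, hprod, inv_mul_cancel_right]
  set γ := α * β * α⁻¹ * β⁻¹ with hγ
  have hNall : Nk (M + 1) = N := Set.Subset.antisymm (hNk _) fun x hx => ⟨hx, hcol x hx⟩
  have hX : ∀ i, i ∈ region (ℓ : ℝ) N₀ (Nk (M + 1)) ↔ ∀ z ∈ N₀, (ℓ : ℝ) < dist i z := by
    intro i
    rw [hNall]
    exact ⟨fun h => h.2, fun h => ⟨hcov i, h⟩⟩
  have hXadm := hadm (hNk (M + 1))
  have hγl : IsLocal (e) s (r : ℝ) γ := by
    have := ((hα.mul hβ).mul (hα.inv he)).mul (hβ.inv he)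
    have hR0 : R + R + R + R ≤ r := by
      rcases le_total 0 R with h | h <;> linarith
    exact this.mono hR0
  have hγγ : ∀ x, γ (γ⁻¹ x) = x := γ.apply_symm_apply
  have hout : ∀ p : P, (∀ z ∈ N₀, (ℓ : ℝ) + r < dist (s p) z) → ∀ a b,
      (γ * (V (M + 1))⁻¹) (e p a b) = e p a b := by
    intro p hp a b
    change γ ((V (M + 1))⁻¹ _) = _
    rw [hvin _ hXadm p ?_ a b, hγγ]
    intro i hi
    rw [hX]
    intro z hz
    have h1 := hp z hz
    have h2 := dist_triangle_left (s p) z i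
    linarith
  have hlast : IsBlockwise e s L (γ * (V (M + 1))⁻¹) := by
    refine ⟨{S | ∃ z ∈ N₀, S = Metric.closedBall z ((ℓ : ℝ) + r)}, ?_, ?_, ?_, ?_, ?_⟩
    · rintro _ ⟨x, hx, rfl⟩ _ ⟨y, hy, rfl⟩ hne
      have hxy : x ≠ y := by rintro rfl; exact hne rfl
      have := hN₀ x hx y hy hxy
      exact Metric.closedBall_disjoint_closedBall (by linarith)
    · rintro _ ⟨x, hx, rfl⟩ i hi i' hi'
      rw [Metric.mem_closedBall] at hi hi'
      have := dist_triangle_right i i' x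
      linarith
    · rintro _ ⟨x, hx, rfl⟩
      refine (hballfin x (ℓ + r) (by linarith)).subset ?_
      intro p hp
      rw [Set.mem_preimage, Metric.mem_closedBall'] at hp
      exact hp
    · rintro _ ⟨z, hz, rfl⟩ p hp a b
      rw [Metric.mem_closedBall] at hp
      have h1 : (V (M + 1))⁻¹ (e p a b) ∈
          net (e) {p' | dist (s p') z ≤ (ℓ : ℝ) + r + r} := by
        refine hvnear _ hXadm z (ℓ + r) ?_ ?_ p hp a b
        · intro p' hp' hd
          obtain ⟨z', hz', h2, -, h3⟩ := hjz p' hp'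
          rw [h3 z hz (by linarith)]
          linarith
        · intro p' hp' hd
          obtain ⟨z', hz', h2, -, h3⟩ := hjz p' hp'
          have hzz : z = z' := by
            by_contra hne
            have h4 := hN₀ z hz z' hz' hne
            have h5 := dist_triangle_left z z' (s (j p'))
            linarith
          by_cases h6 : ∃ z'' ∈ N₀, dist (s p') z'' ≤ (ℓ : ℝ) + r
          · obtain ⟨z'', hz'', h7⟩ := h6
            have := h3 z'' hz'' (by linarith)
            rw [hzz, ← this]
            exact Or.inl h7
          · push Not at h6
            refine Or.inr (Or.inl fun i hi => (hX i).2 fun z'' hz'' => ?_)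
            have h7 := h6 z'' hz''
            have h8 := dist_triangle_left (s p') z'' i
            linarith
      have h2 : (γ * (V (M + 1))⁻¹) (e p a b) ∈
          net (e) {p' | dist (s p') z ≤ (ℓ : ℝ) + r + r + r} := by
        refine hγl.map_mem h1 ?_
        intro p' hp' p'' hp''
        have h3 : dist (s p') z ≤ (ℓ : ℝ) + r + r := hp'
        have := dist_triangle (s p'') (s p') z
        change dist (s p'') z ≤ (ℓ : ℝ) + r + r + r
        linarith
      rw [he.mem_net_iff] at h2 ⊢
      intro p' hp' c d
      rw [Set.mem_preimage, Metric.mem_closedBall, not_le] at hp'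
      by_cases h3 : dist (s p') z ≤ (ℓ : ℝ) + r + r + r
      · have h4 := hout p' (by
          intro z' hz'
          by_cases hzz : z = z'
          · rwa [← hzz]
          · have h5 := hN₀ z hz z' hz' hzz
            have h6 := dist_triangle_left z z' (s p')
            linarith) c d
        rw [← h4]
        refine Commute.map ?_ _
        refine he.units.commute _ _ ?_ a b c d
        rintro rfl
        linarith
      · exact h2 p' h3 c d
    · intro p hp a b
      refine hout p (fun z hz => ?_) a b
      have := hp _ ⟨z, hz, rfl⟩
      rwa [Metric.mem_closedBall, not_le] at this
  obtain ⟨l, hlen, hl, hprod⟩ := hV (M + 1)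
  refine ⟨(γ * (V (M + 1))⁻¹) :: l, by simp [hlen], ?_, ?_⟩
  · rintro θ (_ | ⟨_, hθ⟩)
    · exact hlast
    · exact hl θ hθ
  · rw [List.prod_cons, hprod, inv_mul_cancel_right]

end Factorization

section Double

variable (P : Type u) (q : ℕ)

/-- The matrix units of the doubled system. -/
def doubleUnit (x : P ⊕ P) (a b : Fin q) : LocalAlgebra (quditBasis (fun _ : P ⊕ P => 1) q) :=
  quditUnit (fun _ : P ⊕ P => 1) q ⟨x, 0⟩ a b

theorem doubleUnit_isQuditAlgebra : IsQuditAlgebra (doubleUnit P q) where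
  units := (quditUnit_isQuditAlgebra (fun _ : P ⊕ P => 1) q).units.comp
    (τ := fun x => ⟨x, 0⟩) (fun x y h => congrArg Sigma.fst h)
  gen := by
    rw [eq_top_iff, ← (quditUnit_isQuditAlgebra (fun _ : P ⊕ P => 1) q).gen]
    refine net_le ?_
    rintro ⟨x, k⟩ - a b
    rw [Subsingleton.elim k 0]
    exact unit_mem_net (e := doubleUnit P q) (Set.mem_univ x) a b

end Double

section Group

theorem exists_normal_subgroupOf_commutative {G : Type*} [Group G] (H K : Subgroup G)
    (h : ∀ x ∈ K, ∀ y ∈ K, x * y * x⁻¹ * y⁻¹ ∈ H) :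
    ∃ _ : (H.subgroupOf K).Normal, ∀ x y : K ⧸ H.subgroupOf K, x * y = y * x := by
  refine ⟨⟨fun x hx y => ?_⟩, fun x y => ?_⟩
  · rw [Subgroup.mem_subgroupOf] at hx ⊢
    have := mul_mem (h y y.2 x x.2) hx
    rwa [inv_mul_cancel_right] at this
  · induction x using QuotientGroup.induction_on with
    | H x =>
      induction y using QuotientGroup.induction_on with
      | H y =>
        refine QuotientGroup.eq.2 ?_
        rw [Subgroup.mem_subgroupOf]
        have := h _ (inv_mem y.2) _ (inv_mem x.2)
        simpa [mul_assoc] using this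

end Group

section Circuits

variable {I : Type u} [PseudoMetricSpace I] {n : I → ℕ} {q : ℕ}

theorem exists_rounds_of_isBlockwise [NeZero q] {r : ℝ} (l : List (Aut (quditBasis n q)))
    (hl : ∀ θ ∈ l, IsBlockwise (quditUnit n q) Sigma.fst r θ) :
    ∃ Ls : List (Round (quditBasis n q) r), Ls.length = l.length ∧ ImplementsRounds Ls l.prod := by
  induction l with
  | nil => exact ⟨[], rfl, rfl⟩
  | cons θ l ih =>
    obtain ⟨Ls, hlen, hLs⟩ := ih fun θ' hθ' => hl θ' (List.mem_cons_of_mem _ hθ')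
    obtain ⟨sets, h1, h2, h3, h4, h5⟩ := hl θ List.mem_cons_self
    obtain ⟨L, hL⟩ := exists_round sets h1 h2 h3 θ h4 h5
    have hL' : ImplementsRounds [L] θ := ⟨θ, 1, hL, rfl, (one_mul θ).symm⟩
    refine ⟨Ls ++ [L], by simp [hlen], ?_⟩
    rw [List.prod_cons]
    exact implementsRounds_append hLs hL'

/-- On sufficiently dense systems, commutators of QCA are circuits without ancillas. -/
theorem exists_circuit_commutator (c c' d : ℝ) (hc : 0 < c) (hcc' : c ≤ c') (hd : 0 < d) (R : ℝ)
    (hR : 0 < R) :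
    ∃ (ℓ₀ : ℝ) (D : ℕ) (ρ : ℝ),
      ∀ (I : Type u) [PseudoMetricSpace I] (n : I → ℕ) (q : ℕ), 0 < q →
        DensityAssumption n n c c' d ℓ₀ →
        ∀ α β : Aut (quditBasis n q), IsQCA R α → IsQCA R β →
          ∃ C : Circuit (quditBasis n q),
            C.depth ≤ D ∧ C.range ≤ ρ ∧ C.Implements (α * β * α⁻¹ * β⁻¹) := by
  set r := ⌈6 * R⌉₊ with hr
  have hr1 : 1 ≤ r := Nat.one_le_iff_ne_zero.2 (Nat.ceil_pos.2 (by linarith)).ne'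
  obtain ⟨ℓ, hrℓ, hA1, hscale⟩ := exists_scale c c' d hc (hc.trans_le hcc') hd r
  set L := 2 * (ℓ + 2 * (r + 2 * (4 * ℓ + 5 * r))) with hL
  refine ⟨(L + ℓ : ℕ), ∑ t ∈ Finset.Icc 1 (L + ℓ), ⌊c' * (t : ℝ) ^ (d - 1)⌋₊ + 2,
    L * (∑ t ∈ Finset.Icc 1 (L + ℓ), ⌊c' * (t : ℝ) ^ (d - 1)⌋₊ + 2 : ℕ), ?_⟩
  intro I _ n q hq hdens α β hα hβ
  have : NeZero q := ⟨hq.ne'⟩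
  have := localAlgebra_nontrivial n q
  have := localAlgebra_nontrivial (fun _ : (Σ i, Fin (n i)) ⊕ (Σ i, Fin (n i)) => 1) q
  have hrℓ' : 10 * (r : ℝ) + 10 ≤ ℓ := by exact_mod_cast hrℓ
  have hr0 : (0 : ℝ) ≤ r := Nat.cast_nonneg r
  obtain ⟨l, hlen, hl, hprod⟩ := exists_blockwise_factorization (quditUnit_isQuditAlgebra n q)
    (doubleUnit_isQuditAlgebra (Σ i, Fin (n i)) q) (Λ := L + ℓ) hr1 (Nat.le_ceil _) rfl hL le_rfl
    hrℓ (fun x => (hdens x ((ℓ : ℝ) / 2) (by linarith) (by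
      push_cast
      linarith [Nat.cast_nonneg (α := ℝ) L])).1) hA1
    (fun x t ht htΛ => (hdens x t (by exact_mod_cast ht) (by exact_mod_cast htΛ)).2)
    hscale hα.isLocal hβ.isLocal
  obtain ⟨Ls, hlen', hLs⟩ := exists_rounds_of_isBlockwise l hl
  rw [hprod] at hLs
  have hlen'' := hlen'.trans hlen
  refine ⟨⟨L, Nat.cast_nonneg _, Ls, ?_⟩, hlen''.le, ?_, hLs⟩
  · rintro rfl
    simp at hlen''
  · exact (congrArg (fun k : ℕ => (L : ℝ) * k) hlen'').le

theorem IsQCA.mono {R R' : ℝ} {α : Aut (quditBasis n q)} (h : IsQCA R α) (hR : R ≤ R') :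
    IsQCA R' α :=
  (h.isLocal.mono hR).isQCA

theorem exists_isQCA_of_mem_qcaGroup [NeZero q] {α : Aut (quditBasis n q)}
    (hα : α ∈ qcaGroup (quditBasis n q)) : ∃ R : ℝ, 0 < R ∧ IsQCA R α := by
  induction hα using Subgroup.closure_induction with
  | mem α hα => exact hα
  | one =>
    refine ⟨1, one_pos, fun J O hO => SupportedOn.mono hO fun i hi => ⟨i, hi, ?_⟩⟩
    rw [dist_self]
    exact zero_le_one
  | mul α β _ _ ihα ihβ =>
    obtain ⟨R, hR, hα⟩ := ihα
    obtain ⟨R', hR', hβ⟩ := ihβ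
    exact ⟨R + R', add_pos hR hR', (hα.isLocal.mul hβ.isLocal).isQCA⟩
  | inv α _ ih =>
    obtain ⟨R, hR, hα⟩ := ih
    exact ⟨R, hR, (hα.isLocal.inv (quditUnit_isQuditAlgebra n q)).isQCA⟩

theorem qcaModCircuitsIsAbelian_of_commutator_mem [NeZero q]
    (h : ∀ R : ℝ, 0 < R → ∀ α β : Aut (quditBasis n q), IsQCA R α → IsQCA R β →
      α * β * α⁻¹ * β⁻¹ ∈ circuitGroup (quditBasis n q)) :
    QCAModCircuitsIsAbelian (quditBasis n q) := by
  have hcomm : ∀ x ∈ qcaGroup (quditBasis n q), ∀ y ∈ qcaGroup (quditBasis n q),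
      x * y * x⁻¹ * y⁻¹ ∈ circuitGroup (quditBasis n q) := by
    intro x hx y hy
    obtain ⟨R, hR, hx⟩ := exists_isQCA_of_mem_qcaGroup hx
    obtain ⟨R', hR', hy⟩ := exists_isQCA_of_mem_qcaGroup hy
    exact h (R + R') (add_pos hR hR') _ _ (hx.mono (by linarith)) (hy.mono (by linarith))
  exact exists_normal_subgroupOf_commutative _ _ hcomm

end Circuits

end QCA

end

theorem mainTheorem3 (c c' d : ℝ) (hc : 0 < c) (hcc' : c ≤ c') (hd : 0 < d) :
    (∀ R : ℝ, 0 < R →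
      ∃ (ℓ₀ : ℝ) (D : ℕ) (ρ : ℝ),
        ∀ (I : Type u) [PseudoMetricSpace I] (n : I → ℕ) (q : ℕ), 0 < q →
          QCA.DensityAssumption n n c c' d ℓ₀ →
          ∀ α β : QCA.Aut (QCA.quditBasis n q), QCA.IsQCA R α → QCA.IsQCA R β →
            ∃ C : QCA.Circuit (QCA.quditBasis n q),
              C.depth ≤ D ∧ C.range ≤ ρ ∧ C.Implements (α * β * α⁻¹ * β⁻¹)) ∧
    (∀ (I : Type u) [PseudoMetricSpace I] (n : I → ℕ) (q : ℕ), 0 < q →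
      (∀ ℓ₀ : ℝ, QCA.DensityAssumption n n c c' d ℓ₀) →
      QCA.QCAModCircuitsIsAbelian (QCA.quditBasis n q)) := by
  refine ⟨fun R hR => QCA.exists_circuit_commutator c c' d hc hcc' hd R hR, ?_⟩
  intro I _ n q hq hdens
  have : NeZero q := ⟨hq.ne'⟩
  refine QCA.qcaModCircuitsIsAbelian_of_commutator_mem fun R hR α β hα hβ => ?_
  obtain ⟨ℓ₀, D, ρ, h⟩ := QCA.exists_circuit_commutator c c' d hc hcc' hd R hR
  obtain ⟨C, -, -, hC⟩ := h I n q hq (hdens ℓ₀) α β hα hβ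
  exact ⟨C, hC⟩
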